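/- Let $\Bbbk$ be a field, let $N\ge 0$, and let $\mathrm{pers}(\mathbf Z^N)$ be the abelian category of $\mathbf Z^N$-persistence modules, i.e. functors $M\colon \mathbf Z^N\to\mathbf{vec}_{\Bbbk}$, $z\mapsto M_z$, from the poset $\mathbf Z^N$ (product order) to finite-dimensional $\Bbbk$-vector spaces. For $z\in\mathbf Z^N$ let $F(z)$ be the module with $F(z)_v=\Bbbk$ if $z\le v$ and $F(z)_v=0$ otherwise, with identities as structure maps between non-zero components. A module is *free of finite rank* if it is isomorphic to a finite direct sum of modules $F(z)$. The pointwise dual $M^*$ of a persistence module $M$ has components $(M^*)_z=\operatorname{Hom}_{\Bbbk}(M_{-z},\Bbbk)$. The global dual $M^\dagger$ of a free module $M$ of finite rank has components $(M^\dagger)_z=\operatorname{Hom}(M,F(\mathbf 1)\langle z\rangle)$, where $\mathbf 1=(1,\dots,1)$ and $L\langle z\rangle_v=L_{z+v}$. Let $\nu=((-)^\dagger)^*$ be the Nakayama functor, from free modules of finite rank to persistence modules, applied degreewise to chain complexes. For a $\mathbf Z$-indexed chain complex $C$ let $C[i]$ be the shifted complex with $C[i]_d=C_{d+i}$ (and differential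 multiplied by $(-1)^i$). Let $\mathcal D(\mathrm{pers}(\mathbf Z^N))$ be the derived category, i.e. the localization of the category of $\mathbf Z$-indexed chain complexes in $\mathrm{pers}(\mathbf Z^N)$ with respect to quasi-isomorphisms. A persistence module $M$ *eventually vanishes* if $\{z : M_z\neq 0\}$ is bounded above in $\mathbf Z^N$, and a chain complex $C$ is *eventually acyclic* if $H_d(C)$ eventually vanishes for every $d$. **Theorem.** There exists, for every $\mathbf Z$-indexed (possibly unbounded) chain complex $C$ of free $\mathbf Z^N$-persistence modules of finite rank, a morphism $\varphi_C\colon \nu C[N]\to C$ in $\mathcal D(\mathrm{pers}(\mathbf Z^N))$, natural in $C$ with respect to chain maps, such that for each such $C$: 1. for every $d\in\mathbf Z$, if each of the modules $H_d(C),\dots,H_{d+N}(C)$ eventually vanishes, then $$H_d(\varphi_C)\colon H_{d+N}(\nu C)\to H_d(C)$$ is an isomorphism; 2. if $C$ is eventually acyclic, then $\varphi_C$ is an isomorphism in $\mathcal D(\mathrm{pers}(\mathbf Z^N))$. -/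

import Mathlib

open CategoryTheory CategoryTheory.Limits

universe u w

noncomputable section

namespace MultiPers

/-- The set `ℤ^N` of grades. It is a type of its own (rather than an abbreviation) only so that, as
a category, it carries the structure coming from the product partial order. -/
def Grade (N : ℕ) : Type := Fin N → ℤ

instance (N : ℕ) : PartialOrder (Grade N) := inferInstanceAs (PartialOrder (Fin N → ℤ))

instance (N : ℕ) : AddCommGroup (Grade N) := inferInstanceAs (AddCommGroup (Fin N → ℤ))

instance (N : ℕ) : IsOrderedAddMonoid (Grade N) :=
  inferInstanceAs (IsOrderedAddMonoid (Fin N → ℤ))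

/-- The grade `𝟏 = (1, …, 1)`. -/
def Grade.ones (N : ℕ) : Grade N := fun _ => 1

/-- The category of `ℤ^N`-persistence modules over the field `k`: functors from the poset `ℤ^N`
(product order) to finite-dimensional `k`-vector spaces. -/
abbrev Pers (k : Type u) [Field k] (N : ℕ) : Type (u + 1) := Grade N ⥤ FGModuleCat.{u} k

variable {k : Type u} [Field k] {N : ℕ}

instance : HasFiniteBiproducts (Pers k N) := Abelian.hasFiniteBiproducts

/-! ### Free persistence modules -/

open Classical in
/-- The component of `F(z)` in grade `v`, as a subspace of `k`: it is `k` if `z ≤ v`, and `0`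
otherwise. -/
def freeComponent (k : Type u) [Field k] {N : ℕ} (z v : Grade N) : Submodule k k :=
  if z ≤ v then ⊤ else ⊥

lemma freeComponent_mono (z : Grade N) {v v' : Grade N} (h : v ≤ v') :
    freeComponent k z v ≤ freeComponent k z v' := by
  unfold freeComponent
  by_cases hz : z ≤ v
  · simp [hz, hz.trans h]
  · simp [hz]

/-- The free persistence module `F(z)` on one generator of grade `z`; its structure maps are the
inclusions of subspaces of `k`. -/
def freeOn (k : Type u) [Field k] {N : ℕ} (z : Grade N) : Pers k N where
  obj v := FGModuleCat.of k (freeComponent k z v)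
  map f := FGModuleCat.ofHom (Submodule.inclusion (freeComponent_mono z (leOfHom f)))

/-- A persistence module is free of finite rank if it is isomorphic to a finite direct sum of
modules `F(z)`. -/
def isFreeOfFiniteRank (k : Type u) [Field k] (N : ℕ) : ObjectProperty (Pers k N) :=
  fun M => ∃ (n : ℕ) (z : Fin n → Grade N), Nonempty ((⨁ fun i => freeOn k (z i)) ≅ M)

/-- The full subcategory of `Pers k N` on the free modules of finite rank. -/
abbrev FreePers (k : Type u) [Field k] (N : ℕ) : Type (u + 1) :=
  (isFreeOfFiniteRank k N).FullSubcategory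

/-! ### The internal Hom -/

/-- Translation by `z` on the poset `ℤ^N`. -/
def translate (z : Grade N) : Grade N ⥤ Grade N where
  obj v := z + v
  map f := homOfLE (add_le_add_right (leOfHom f) z)

/-- The graded shift `M⟨z⟩`, with components `M⟨z⟩_v = M_{z+v}`. -/
def gradeShift (M : Pers k N) (z : Grade N) : Pers k N := translate z ⋙ M

/-- The morphism `M⟨z⟩ ⟶ M⟨z'⟩` given by the structure maps of `M`, for `z ≤ z'`. -/
def gradeShiftMap (M : Pers k N) {z z' : Grade N} (h : z ≤ z') :
    gradeShift M z ⟶ gradeShift M z' where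
  app v := M.map (homOfLE (add_le_add_left h v))
  naturality _ _ _ := by
    simp only [gradeShift, Functor.comp_map, ← M.map_comp]
    rfl

lemma gradeShiftMap_refl (M : Pers k N) (z : Grade N) :
    gradeShiftMap M (le_refl z) = 𝟙 (gradeShift M z) := by
  ext1; funext v
  exact M.map_id (z + v)

lemma gradeShiftMap_trans (M : Pers k N) {a b c : Grade N} (h : a ≤ b) (h' : b ≤ c) :
    gradeShiftMap M (h.trans h') = gradeShiftMap M h ≫ gradeShiftMap M h' := by
  ext1; funext v
  exact M.map_comp (homOfLE (add_le_add_left h v)) (homOfLE (add_le_add_left h' v))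

/-- The internal Hom of persistence modules: `Hom(L, M)_z = Hom(L, M⟨z⟩)`. In general its
components are not finite-dimensional. -/
def internalHom (L M : Pers k N) : Grade N ⥤ ModuleCat.{u} k where
  obj z := ModuleCat.of k (L ⟶ gradeShift M z)
  map f := ModuleCat.ofHom (Linear.rightComp k L (gradeShiftMap M (leOfHom f)))
  map_id z := by
    ext f : 2
    change f ≫ gradeShiftMap M (le_refl z) = f
    rw [gradeShiftMap_refl, Category.comp_id]
  map_comp {a b c} f g := by
    ext x : 2
    change x ≫ gradeShiftMap M ((leOfHom f).trans (leOfHom g)) =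
      (x ≫ gradeShiftMap M (leOfHom f)) ≫ gradeShiftMap M (leOfHom g)
    rw [gradeShiftMap_trans, Category.assoc]

/-- Precomposition with `f : L ⟶ L'` as a morphism `Hom(L', M) ⟶ Hom(L, M)`. -/
def internalHomMap {L L' : Pers k N} (f : L ⟶ L') (M : Pers k N) :
    internalHom L' M ⟶ internalHom L M where
  app z := ModuleCat.ofHom (Linear.leftComp k (gradeShift M z) f)
  naturality z z' g := by
    ext x : 2
    exact (Category.assoc f x (gradeShiftMap M (leOfHom g))).symm

/-- The morphism spaces out of `F(z)` are determined by the value at the generator. -/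
lemma freeOn_hom_ext {z : Grade N} {M : Pers k N} {f g : freeOn k z ⟶ M}
    (h : ∀ x, (f.app z).hom.hom x = (g.app z).hom.hom x) : f = g := by
  ext v x
  obtain ⟨x, hx⟩ := x
  by_cases hz : z ≤ v
  · have hx' : x ∈ freeComponent k z z := by simp [freeComponent]
    have e : ∀ f : freeOn k z ⟶ M, (f.app v).hom.hom ⟨x, hx⟩ =
        (M.map (homOfLE hz)).hom.hom ((f.app z).hom.hom ⟨x, hx'⟩) := fun f =>
      congrArg (fun (m : (freeOn k z).obj z ⟶ M.obj v) => m.hom.hom ⟨x, hx'⟩)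
        (f.naturality (homOfLE hz))
    exact (e f).trans ((congrArg (M.map (homOfLE hz)).hom.hom (h ⟨x, hx'⟩)).trans (e g).symm)
  · have h0 : x = 0 := by simpa [freeComponent, hz] using hx
    subst h0
    exact ((f.app v).hom.hom.map_zero).trans ((g.app v).hom.hom.map_zero).symm

/-- For `L` free of finite rank, all morphism spaces out of `L` are finite-dimensional. -/
lemma finite_hom_of_free {L : Pers k N} (hL : isFreeOfFiniteRank k N L) (M : Pers k N) :
    Module.Finite k (L ⟶ M) := by
  obtain ⟨n, z, ⟨e⟩⟩ := hL
  let Φ : (L ⟶ M) →ₗ[k] (∀ i : Fin n, (freeOn k (z i)).obj (z i) ⟶ M.obj (z i)) :=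
    LinearMap.pi fun i => (NatTrans.appLinearMap (R := k) (z i)).comp
      (Linear.leftComp k M (biproduct.ι (fun i => freeOn k (z i)) i ≫ e.hom))
  refine Module.Finite.of_injective Φ fun f g hfg => ?_
  rw [← cancel_epi e.hom]
  refine biproduct.hom_ext' _ _ fun i => freeOn_hom_ext fun x => ?_
  have := congrFun hfg i
  have h2 : ((biproduct.ι (fun i => freeOn k (z i)) i ≫ e.hom) ≫ f).app (z i) =
    ((biproduct.ι (fun i => freeOn k (z i)) i ≫ e.hom) ≫ g).app (z i) := this
  rw [Category.assoc, Category.assoc] at h2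
  rw [h2]

/-! ### The two dualities and the Nakayama functor -/

/-- The global dual `M^† = Hom(M, F(𝟏))`, as a functor on free modules of finite rank (for which
its components are finite-dimensional). -/
def globalDual (k : Type u) [Field k] (N : ℕ) : (FreePers k N)ᵒᵖ ⥤ Pers k N where
  obj M := (ModuleCat.isFG k).lift (internalHom M.unop.obj (freeOn k (Grade.ones N)))
    fun z => finite_hom_of_free M.unop.property (gradeShift (freeOn k (Grade.ones N)) z)
  map f :=
    { app := fun z => ObjectProperty.homMk
        ((internalHomMap f.unop.hom (freeOn k (Grade.ones N))).app z)
      naturality := fun _ _ g => ObjectProperty.hom_ext _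
        ((internalHomMap f.unop.hom (freeOn k (Grade.ones N))).naturality g) }
  map_id M := by
    ext z f : 5
    exact Category.id_comp (X := M.unop.obj) f
  map_comp f g := by
    ext z x : 5
    exact Category.assoc g.unop.hom f.unop.hom x

/-- The pointwise (Matlis) dual `M^*`, with components `(M^*)_z = (M_{-z})^*` and structure maps the
transposes of those of `M`. -/
def pointwiseDual (k : Type u) [Field k] (N : ℕ) : (Pers k N)ᵒᵖ ⥤ Pers k N where
  obj M :=
    { obj := fun z => FGModuleCat.of k (Module.Dual k (M.unop.obj (-z)))
      map := fun f => FGModuleCat.ofHom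
        (M.unop.map (homOfLE (neg_le_neg (leOfHom f)))).hom.hom.dualMap
      map_id := fun z => by
        ext f x
        exact congrArg (fun m : M.unop.obj (-z) ⟶ M.unop.obj (-z) => f (m.hom.hom x))
          (M.unop.map_id (-z))
      map_comp := fun {a b c} g h => by
        ext f x
        exact congrArg (fun m : M.unop.obj (-c) ⟶ M.unop.obj (-a) => f (m.hom.hom x))
          (M.unop.map_comp (homOfLE (neg_le_neg (leOfHom h)))
            (homOfLE (neg_le_neg (leOfHom g)))) }
  map {M M'} f :=
    { app := fun z => FGModuleCat.ofHom (f.unop.app (-z)).hom.hom.dualMap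
      naturality := fun {a b} g => by
        ext x y
        exact congrArg (x : Module.Dual k _) (congrArg
          (fun m : M'.unop.obj (-b) ⟶ M.unop.obj (-a) => m.hom.hom y)
          (f.unop.naturality (homOfLE (neg_le_neg (leOfHom g))))).symm }
  map_id _ := by
    ext z f x
    rfl
  map_comp _ _ := by
    ext z f x
    rfl

/-- The Nakayama functor `ν = ((-)^†)^*`, on free modules of finite rank. -/
def nakayama (k : Type u) [Field k] (N : ℕ) : FreePers k N ⥤ Pers k N :=
  (globalDual k N).rightOp ⋙ pointwiseDual k N

instance (k : Type u) [Field k] (N : ℕ) : (nakayama k N).Additive where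
  map_add {X Y f g} := by
    ext z φ
    refine LinearMap.ext fun x => ?_
    let ψ : Module.Dual k (X.obj ⟶ gradeShift (freeOn k (Grade.ones N)) (-z)) := φ
    let x' : Y.obj ⟶ gradeShift (freeOn k (Grade.ones N)) (-z) := x
    change ψ ((f.hom + g.hom) ≫ x') = ψ (f.hom ≫ x') + ψ (g.hom ≫ x')
    rw [Preadditive.add_comp]
    exact ψ.map_add _ _

/-! ### Chain complexes and their homology -/

/-- The homological shift `C[i]`, with `C[i]_d = C_{d+i}` and differential multiplied by
`(-1)^i`. -/
def chainShift (A : Type*) [Category* A] [Preadditive A] (i : ℤ) :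
    ChainComplex A ℤ ⥤ ChainComplex A ℤ where
  obj K :=
    { X := fun d => K.X (d + i)
      d := fun _ _ => i.negOnePow • K.d _ _
      d_comp_d' := by
        intros
        simp only [Linear.comp_units_smul, Linear.units_smul_comp, HomologicalComplex.d_comp_d,
          smul_zero]
      shape := fun a b hab => by
        rw [K.shape, smul_zero]
        intro hab'
        apply hab
        simp only [ComplexShape.down_Rel] at hab' ⊢
        lia }
  map f :=
    { f := fun _ => f.f _
      comm' := by
        intros
        dsimp
        simp only [Linear.comp_units_smul, HomologicalComplex.Hom.comm, Linear.units_smul_comp] }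
  map_id _ := rfl
  map_comp _ _ := rfl

/-- The identification `H_d(C[i]) = H_{d+i}(C)`, induced by the identities `C[i]_d = C_{d+i}` (up to
the signs in degrees other than `d`). -/
def chainShiftHomologyIso {A : Type*} [Category* A] [Abelian A] (i : ℤ) (K : ChainComplex A ℤ)
    (d : ℤ) : ((chainShift A i).obj K).homology d ≅ K.homology (d + i) :=
  ShortComplex.homologyMapIso
    (((chainShift A i).obj K).isoSc' (d + 1) d (d - 1) (by simp) (by simp) ≪≫
      ShortComplex.isoMk (S₁ := ((chainShift A i).obj K).sc' (d + 1) d (d - 1))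
        (S₂ := K.sc' (d + 1 + i) (d + i) (d - 1 + i))
        (i.negOnePow • Iso.refl _) (Iso.refl _) (i.negOnePow • Iso.refl _)
        (by
          change (i.negOnePow • 𝟙 (K.X (d + 1 + i))) ≫ K.d (d + 1 + i) (d + i) =
            (i.negOnePow • K.d (d + 1 + i) (d + i)) ≫ 𝟙 (K.X (d + i))
          simp [Linear.units_smul_comp])
        (by
          change 𝟙 (K.X (d + i)) ≫ K.d (d + i) (d - 1 + i) =
            (i.negOnePow • K.d (d + i) (d - 1 + i)) ≫ (i.negOnePow • 𝟙 (K.X (d - 1 + i)))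
          simp [Linear.comp_units_smul, smul_smul]) ≪≫
      (K.isoSc' (d + 1 + i) (d + i) (d - 1 + i) (by simp; lia) (by simp; lia)).symm)

/-- A persistence module eventually vanishes if its support is bounded above. -/
def EventuallyVanishes (M : Pers k N) : Prop := BddAbove {z : Grade N | Nontrivial (M.obj z)}

/-- A chain complex is eventually acyclic if all its homology modules eventually vanish. -/
def EventuallyAcyclic (C : ChainComplex (Pers k N) ℤ) : Prop :=
  ∀ d : ℤ, EventuallyVanishes (C.homology d)

/-! ### The derived category -/

/-- The class of quasi-isomorphisms of chain complexes of persistence modules. -/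
abbrev quasiIsos (k : Type u) [Field k] (N : ℕ) : MorphismProperty (ChainComplex (Pers k N) ℤ) :=
  HomologicalComplex.quasiIso (Pers k N) (ComplexShape.down ℤ)

/-- The derived category of `Pers k N`: the localization of the category of chain complexes with
respect to quasi-isomorphisms. -/
abbrev Derived (k : Type u) [Field k] (N : ℕ) [(quasiIsos k N).HasLocalization] : Type (u + 1) :=
  HomologicalComplexUpToQuasiIso (Pers k N) (ComplexShape.down ℤ)

/-- The localization functor from chain complexes to the derived category. -/
abbrev toDerived (k : Type u) [Field k] (N : ℕ) [(quasiIsos k N).HasLocalization] :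
    ChainComplex (Pers k N) ℤ ⥤ Derived k N :=
  HomologicalComplexUpToQuasiIso.Q

/-- The map `H_d(f) : H_d(K) ⟶ H_d(L)` induced by a morphism `f : K ⟶ L` of the derived
category. -/
def derivedHomologyMap [(quasiIsos k N).HasLocalization] {K L : ChainComplex (Pers k N) ℤ}
    (f : (toDerived k N).obj K ⟶ (toDerived k N).obj L) (d : ℤ) : K.homology d ⟶ L.homology d :=
  (HomologicalComplexUpToQuasiIso.homologyFunctorFactors (Pers k N) (ComplexShape.down ℤ) d).inv.app
      K ≫
    (HomologicalComplexUpToQuasiIso.homologyFunctor (Pers k N) (ComplexShape.down ℤ) d).map f ≫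
    (HomologicalComplexUpToQuasiIso.homologyFunctorFactors (Pers k N)
      (ComplexShape.down ℤ) d).hom.app L

/-- A chain complex of free modules of finite rank, regarded as a chain complex of persistence
modules. -/
abbrev forgetFree (k : Type u) [Field k] (N : ℕ) :
    ChainComplex (FreePers k N) ℤ ⥤ ChainComplex (Pers k N) ℤ :=
  (isFreeOfFiniteRank k N).ι.mapHomologicalComplex (ComplexShape.down ℤ)

/-- The Nakayama functor `C ↦ νC`, applied degreewise to chain complexes. -/
abbrev nakayamaComplex (k : Type u) [Field k] (N : ℕ) :
    ChainComplex (FreePers k N) ℤ ⥤ ChainComplex (Pers k N) ℤ :=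
  (nakayama k N).mapHomologicalComplex (ComplexShape.down ℤ)

end MultiPers

end

open MultiPers

/-! For sets `A`, `B` of coordinates let k_{A,B} be the interval module on the grades that are
positive in `A` and non-positive in `B`, and put T_{A,B}(M) = Hom(M, k_{A,B})^*. With all
coordinates in `A` and none in `B`, k_{A,B} is F(𝟏) and T_{A,B} is the Nakayama functor
(`nakayamaIso`, `boxUnivIso`). With all coordinates in `B` and none in `A`, T_{A,B} is the inclusion
of the free modules, via evaluation M_z → Hom(M, k_{A,B}⟨-z⟩)^* (`boxDualUnivIso`). So φ is obtained
by moving the coordinates one at a time from `A` to `B`.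

Splitting k_{A,B} by the sign of coordinate i gives 0 → k_{A∪i,B} → k_{A,B} → k_{A,B∪i} → 0. Free
modules are projective, so 0 → T_{A,B∪i}C → T_{A,B}C → T_{A∪i,B}C → 0 is exact
(`boxComplex_shortExact`). Its connecting morphism T_{A∪i,B}C[1] → T_{A,B∪i}C lives in the derived
category, is natural in C, and is an isomorphism on the homology degrees around which T_{A,B}C is
exact (`exists_connecting`). The composite of N of these is φ (`exists_boxComplex_hom`).

It remains to see that T_{A,B}C is exact when A ∪ B misses a coordinate. If `A` is empty, T_{∅,B}C
in grade v is computed, around any given degree, by C in a grade that agrees with v on `B` and is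
large elsewhere; eventual vanishing kills the homology there (`boxComplex_exactAt_of_empty`). Each
element added to `A` costs one further homology degree through the long exact sequence
(`boxComplex_exactAt`); this produces the window H_d, …, H_{d+N}. -/

noncomputable section

/-! ### Mapping cones of chain maps -/

namespace ChainCone

variable {A : Type*} [Category* A] [Abelian A]

open HomologicalComplex

/-- The mapping cone of `f : K ⟶ L`, with components `L_{n+1} ⊞ K_n`, placed so that it projects
onto `K`. -/
def cone {K L : ChainComplex A ℤ} (f : K ⟶ L) : ChainComplex A ℤ where
  X n := L.X (n + 1) ⊞ K.X n
  d a b := biprod.desc (-(L.d (a + 1) (b + 1)) ≫ biprod.inl)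
    (biprod.lift (if h : a = b + 1 then f.f a ≫ (L.XIsoOfEq h).hom else 0) (K.d a b))
  shape a b hab := by
    rw [ComplexShape.down_Rel] at hab
    rw [L.shape _ _ (by rw [ComplexShape.down_Rel]; lia),
      K.shape _ _ (by rwa [ComplexShape.down_Rel]), dif_neg (by lia)]
    ext <;> simp
  d_comp_d' a b c hab hbc := by
    rw [ComplexShape.down_Rel] at hab hbc
    subst hbc hab
    ext <;> simp [XIsoOfEq]

variable {K L M : ChainComplex A ℤ}

lemma cone_d_succ (f : K ⟶ L) (n : ℤ) :
    (cone f).d (n + 1) n = biprod.desc (-(L.d (n + 1 + 1) (n + 1)) ≫ biprod.inl)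
      (biprod.lift (f.f (n + 1)) (K.d (n + 1) n)) := by
  simp [cone, XIsoOfEq]

/-- The morphism into a component of the cone with given coordinates. -/
def coneLift (f : K ⟶ L) (n : ℤ) {T : A} (l : T ⟶ L.X (n + 1)) (x : T ⟶ K.X n) :
    T ⟶ (cone f).X n :=
  biprod.lift l x

/-- In generalized elements this is d(l, x) = (-dl + f(x), dx), the only form of the differential
that the diagram chases need. -/
lemma coneLift_d (f : K ⟶ L) (n : ℤ) {T : A} (l : T ⟶ L.X (n + 1 + 1)) (x : T ⟶ K.X (n + 1)) :
    coneLift f (n + 1) l x ≫ (cone f).d (n + 1) n =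
      coneLift f n (-(l ≫ L.d _ _) + x ≫ f.f (n + 1)) (x ≫ K.d _ _) := by
  have aux : ∀ {X Y X' Y' : A} (l : T ⟶ X) (x : T ⟶ Y) (a : X ⟶ X') (b : Y ⟶ X') (c : Y ⟶ Y'),
      biprod.lift l x ≫ biprod.desc (-a ≫ biprod.inl) (biprod.lift b c) =
        biprod.lift (-(l ≫ a) + x ≫ b) (x ≫ c) := fun l x a b c => by
    ext <;> simp
  rw [cone_d_succ]
  exact aux ..

lemma comp_coneLift (f : K ⟶ L) (n : ℤ) {T T' : A} (p : T' ⟶ T) (l : T ⟶ L.X (n + 1))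
    (x : T ⟶ K.X n) : p ≫ coneLift f n l x = coneLift f n (p ≫ l) (p ≫ x) := by
  have aux : ∀ {X Y : A} (l : T ⟶ X) (x : T ⟶ Y),
      p ≫ biprod.lift l x = biprod.lift (p ≫ l) (p ≫ x) := fun l x => by
    ext <;> simp
  exact aux ..

lemma exists_eq_coneLift (f : K ⟶ L) {n : ℤ} {T : A} (x : T ⟶ (cone f).X n) :
    ∃ (l : T ⟶ L.X (n + 1)) (y : T ⟶ K.X n), x = coneLift f n l y :=
  ⟨x ≫ biprod.fst (C := A), x ≫ biprod.snd (C := A),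
    biprod.hom_ext _ _ (biprod.lift_fst _ _).symm (biprod.lift_snd _ _).symm⟩

lemma coneLift_eq_zero_iff (f : K ⟶ L) {n : ℤ} {T : A} {a : T ⟶ L.X (n + 1)} {b : T ⟶ K.X n} :
    coneLift f n a b = 0 ↔ a = 0 ∧ b = 0 :=
  ⟨fun h => ⟨(biprod.lift_fst a b).symm.trans
      ((congrArg (fun m : T ⟶ L.X (n + 1) ⊞ K.X n => m ≫ biprod.fst) h).trans zero_comp),
    (biprod.lift_snd a b).symm.trans
      ((congrArg (fun m : T ⟶ L.X (n + 1) ⊞ K.X n => m ≫ biprod.snd) h).trans zero_comp)⟩,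
    fun h => by
      rw [h.1, h.2]
      exact biprod.hom_ext _ _ ((biprod.lift_fst _ _).trans zero_comp.symm)
        ((biprod.lift_snd _ _).trans zero_comp.symm)⟩

/-- The map of cones induced by a commutative square. -/
def coneMap {K' L' : ChainComplex A ℤ} (f : K ⟶ L) (f' : K' ⟶ L') (a : K ⟶ K') (b : L ⟶ L')
    (h : f ≫ b = a ≫ f') : cone f ⟶ cone f' where
  f n := biprod.map (b.f (n + 1)) (a.f n)
  comm' i j hij := by
    rw [ComplexShape.down_Rel] at hij
    subst hij
    have h' := congrArg (fun φ => φ.f (j + 1)) h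
    simp only [comp_f] at h'
    rw [cone_d_succ, cone_d_succ]
    dsimp only [cone]
    refine biprod.hom_ext' _ _ ?_ ?_
    · refine biprod.hom_ext _ _ ?_ ?_ <;> simp
    · refine biprod.hom_ext _ _ ?_ ?_ <;> simp [h']

/-- The projection of the cone onto `K`. -/
def coneSnd (f : K ⟶ L) : cone f ⟶ K where
  f n := biprod.snd (C := A)
  comm' i j hij := by
    rw [ComplexShape.down_Rel] at hij
    subst hij
    rw [cone_d_succ]
    dsimp only [cone]
    refine biprod.hom_ext' _ _ ?_ ?_ <;> simp

/-- The map from the cone of `f` to `M[1]` induced by `g : L ⟶ M` with `f ≫ g = 0`. -/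
def coneDesc (f : K ⟶ L) (g : L ⟶ M) (w : f ≫ g = 0) :
    cone f ⟶ (MultiPers.chainShift A 1).obj M where
  f n := biprod.fst (C := A) ≫ g.f (n + 1)
  comm' i j hij := by
    rw [ComplexShape.down_Rel] at hij
    subst hij
    have w' := congrArg (fun φ => φ.f (j + 1)) w
    simp only [comp_f, zero_f] at w'
    rw [cone_d_succ]
    dsimp only [cone, MultiPers.chainShift]
    refine biprod.hom_ext' _ _ ?_ ?_ <;> simp [w']

lemma coneLift_coneSnd (f : K ⟶ L) (n : ℤ) {T : A} (l : T ⟶ L.X (n + 1)) (x : T ⟶ K.X n) :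
    coneLift f n l x ≫ (coneSnd f).f n = x :=
  biprod.lift_snd _ _

lemma coneLift_coneDesc (f : K ⟶ L) (g : L ⟶ M) (w : f ≫ g = 0) (n : ℤ) {T : A}
    (l : T ⟶ L.X (n + 1)) (x : T ⟶ K.X n) :
    coneLift f n l x ≫ (coneDesc f g w).f n = l ≫ g.f (n + 1) :=
  biprod.lift_fst_assoc _ _ _

/-- A morphism into `M_{n+1}`, as a morphism into `M[1]_n`. -/
def shiftLift (M : ChainComplex A ℤ) (n : ℤ) {T : A} (m : T ⟶ M.X (n + 1)) :
    T ⟶ ((MultiPers.chainShift A 1).obj M).X n := m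

lemma shiftLift_d (n : ℤ) {T : A} (m : T ⟶ M.X (n + 1 + 1)) :
    shiftLift M (n + 1) m ≫ ((MultiPers.chainShift A 1).obj M).d (n + 1) n =
      shiftLift M n (-(m ≫ M.d (n + 1 + 1) (n + 1))) := by
  dsimp [MultiPers.chainShift, shiftLift]
  simp

/-! ### Diagram chases for the two projections of the cone -/

lemma down_next (n : ℤ) : (ComplexShape.down ℤ).next (n + 1) = n :=
  (ComplexShape.down ℤ).next_eq' rfl

lemma exactAt_iff_refinements (K : ChainComplex A ℤ) (n : ℤ) :
    K.ExactAt (n + 1) ↔ ∀ ⦃T : A⦄ (x : T ⟶ K.X (n + 1)) (_ : x ≫ K.d (n + 1) n = 0),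
      ∃ (T' : A) (p : T' ⟶ T) (_ : Epi p) (y : T' ⟶ K.X (n + 1 + 1)), p ≫ x = y ≫ K.d _ _ :=
  K.exactAt_iff_exact_up_to_refinements _ _ _ (ChainComplex.prev ℤ _) (down_next n)

/-- The kernel of the projection is `L` shifted by one. Exactness of `L` in degree `d + 1` gives
injectivity on homology, and in degree `d` surjectivity. -/
lemma isIso_homologyMap_coneSnd (f : K ⟶ L) (d : ℤ) (h₀ : L.ExactAt d) (h₁ : L.ExactAt (d + 1)) :
    IsIso (homologyMap (coneSnd f) d) := by
  obtain ⟨n, rfl⟩ : ∃ n, d = n + 1 := ⟨d - 1, by lia⟩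
  rw [exactAt_iff_refinements] at h₀ h₁
  have : Mono (homologyMap (coneSnd f) (n + 1)) := by
    rw [mono_homologyMap_iff_up_to_refinements _ _ _ _ (ChainComplex.prev ℤ _) (down_next n)]
    intro T x hx y hxy
    obtain ⟨l, a, rfl⟩ := exists_eq_coneLift f x
    rw [coneLift_d, coneLift_eq_zero_iff] at hx
    rw [coneLift_coneSnd] at hxy
    -- If the second coordinate is the boundary of y, then l - f(y) is a cycle of `L`, hence locally
    -- a boundary; its primitive corrects the first coordinate.
    obtain ⟨T', p, hp, l', hl'⟩ := h₁ (l - y ≫ f.f _) (by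
      rw [Preadditive.sub_comp, Category.assoc, f.comm, ← Category.assoc, ← hxy, sub_eq_zero]
      exact (neg_add_eq_zero.1 hx.1))
    refine ⟨T', p, hp, coneLift f _ (-l') (p ≫ y), ?_⟩
    rw [coneLift_d, comp_coneLift, Preadditive.neg_comp, neg_neg, ← hl', Category.assoc,
      Category.assoc, ← hxy, Preadditive.comp_sub, sub_add_cancel]
  have : Epi (homologyMap (coneSnd f) (n + 1)) := by
    rw [epi_homologyMap_iff_up_to_refinements _ _ _ _ (ChainComplex.prev ℤ _) (down_next n)]
    intro T y hy
    obtain ⟨T', p, hp, l, hl⟩ := h₀ (y ≫ f.f _) (by rw [Category.assoc, f.comm, reassoc_of% hy,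
      zero_comp])
    refine ⟨T', p, hp, coneLift f _ l (p ≫ y), ?_, 0, ?_⟩
    · rw [coneLift_d, coneLift_eq_zero_iff, Category.assoc, Category.assoc, hl, neg_add_cancel, hy,
        comp_zero]
      exact ⟨rfl, rfl⟩
    · rw [coneLift_coneSnd, zero_comp, add_zero]
  exact isIso_of_mono_of_epi _

/-- As `f` is degreewise the kernel of `g` and `g` is degreewise epi, a chain in `M` lifts locally
to `L`, and the defect of the lift is a chain of `K`, which is the second coordinate in the cone. -/
lemma quasiIso_coneDesc (f : K ⟶ L) (g : L ⟶ M) (w : f ≫ g = 0)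
    (h : (ShortComplex.mk f g w).ShortExact) : QuasiIso (coneDesc f g w) := by
  have hs := (shortExact_iff_degreewise_shortExact _).1 h
  have hmono : ∀ n, Mono (f.f n) := fun n => (hs n).mono_f
  have hepi : ∀ n, Epi (g.f n) := fun n => (hs n).epi_g
  have hlift : ∀ n {T : A} (l : T ⟶ L.X n), l ≫ g.f n = 0 → ∃ x : T ⟶ K.X n, x ≫ f.f n = l :=
    fun n T l hl => have : Mono ((ShortComplex.mk f g w).map (eval A _ n)).f := hmono n
      ⟨(hs n).exact.lift l hl, (hs n).exact.lift_f l hl⟩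
  refine ⟨fun d => (quasiIsoAt_iff_isIso_homologyMap _ _).2 ?_⟩
  obtain ⟨n, rfl⟩ : ∃ n, d = n + 1 := ⟨d - 1, by lia⟩
  have : Mono (homologyMap (coneDesc f g w) (n + 1)) := by
    rw [mono_homologyMap_iff_up_to_refinements _ _ _ _ (ChainComplex.prev ℤ _) (down_next n)]
    intro T x hx (y : T ⟶ M.X (n + 1 + 1 + 1)) hxy
    obtain ⟨l, a, rfl⟩ := exists_eq_coneLift f x
    rw [coneLift_d, coneLift_eq_zero_iff] at hx
    have hxy' : l ≫ g.f _ = -(y ≫ M.d _ _) := by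
      rw [← coneLift_coneDesc f g w _ l a]
      exact hxy.trans (shiftLift_d _ _)
    obtain ⟨T', p, hp, l', hl'⟩ :=
      surjective_up_to_refinements_of_epi (g.f (n + 1 + 1 + 1)) y
    -- The differential of M[1] carries a sign, so l maps to -dy; adding dl' for a lift l' of y
    -- gives an element of the kernel of `g`.
    obtain ⟨b, hb⟩ := hlift _ (p ≫ l + l' ≫ L.d _ _) (by
      rw [Preadditive.add_comp, Category.assoc, hxy', Category.assoc, ← g.comm, ← reassoc_of% hl',
        Preadditive.comp_neg, neg_add_cancel])
    refine ⟨T', p, hp, coneLift f _ l' b, ?_⟩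
    have hb' : b ≫ K.d _ (n + 1) = p ≫ a := by
      rw [← cancel_mono (f.f (n + 1)), Category.assoc, ← f.comm, reassoc_of% hb,
        Preadditive.add_comp, Category.assoc, Category.assoc, L.d_comp_d, comp_zero, add_zero,
        neg_add_eq_zero.1 hx.1, Category.assoc]
    rw [coneLift_d, comp_coneLift, hb, hb', add_comm (p ≫ l), neg_add_cancel_left]
  have : Epi (homologyMap (coneDesc f g w) (n + 1)) := by
    rw [epi_homologyMap_iff_up_to_refinements _ _ _ _ (ChainComplex.prev ℤ _) (down_next n)]
    intro T (y : T ⟶ M.X (n + 1 + 1)) hy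
    have hy' : y ≫ M.d (n + 1 + 1) (n + 1) = 0 := by
      rw [← neg_eq_zero]
      exact (shiftLift_d n _).symm.trans hy
    obtain ⟨T', p, hp, l, hl⟩ :=
      surjective_up_to_refinements_of_epi (g.f (n + 1 + 1)) y
    obtain ⟨b, hb⟩ := hlift _ (l ≫ L.d _ (n + 1)) (by
      rw [Category.assoc, ← g.comm, ← reassoc_of% hl, hy', comp_zero])
    refine ⟨T', p, hp, coneLift f _ l b, ?_, 0, ?_⟩
    · rw [coneLift_d, coneLift_eq_zero_iff, hb, neg_add_cancel, ← cancel_mono (f.f n),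
        Category.assoc, ← f.comm, reassoc_of% hb, L.d_comp_d, comp_zero, zero_comp]
      exact ⟨rfl, rfl⟩
    · rw [coneLift_coneDesc, zero_comp]
      exact hl.trans (add_zero _).symm
  exact isIso_of_mono_of_epi _

/-! ### Natural connecting morphisms in the derived category -/

/-- The cone of a natural transformation between functors to chain complexes. -/
def coneFunctor {D : Type*} [Category* D] {F G : D ⥤ ChainComplex A ℤ} (f : F ⟶ G) :
    D ⥤ ChainComplex A ℤ where
  obj X := cone (f.app X)
  map a := coneMap _ _ (F.map a) (G.map a) (f.naturality a).symm
  map_id X := by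
    ext n : 1
    have aux : ∀ X Y : A, biprod.map (𝟙 X) (𝟙 Y) = 𝟙 (X ⊞ Y) := fun X Y => by ext <;> simp
    simp only [coneMap, F.map_id, G.map_id, id_f]
    exact aux ..
  map_comp {X Y Z} a b := by
    ext n : 1
    have aux : ∀ {X Y X' Y' X'' Y'' : A} (s : X ⟶ X') (t : X' ⟶ X'') (s' : Y ⟶ Y') (t' : Y' ⟶ Y''),
      biprod.map (s ≫ t) (s' ≫ t') = biprod.map s s' ≫ biprod.map t t' := fun s t s' t' => by
        ext <;> simp
    simp only [coneMap, F.map_comp, G.map_comp, comp_f]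
    exact aux ..

section

variable {D : Type*} [Category* D] {F G H : D ⥤ ChainComplex A ℤ}

/-- The natural projection of the cone onto the source. -/
def coneFunctorSnd (f : F ⟶ G) : coneFunctor f ⟶ F where
  app X := coneSnd (f.app X)
  naturality X Y a := by
    ext n : 1
    exact biprod.map_snd _ _

/-- The natural map from the cone to the shifted cokernel. -/
def coneFunctorDesc (f : F ⟶ G) (g : G ⟶ H) (w : f ≫ g = 0) :
    coneFunctor f ⟶ H ⋙ MultiPers.chainShift A 1 where
  app X := coneDesc (f.app X) (g.app X) (by rw [← NatTrans.comp_app, w]; rfl)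
  naturality X Y a := by
    ext n : 1
    have := congrArg (fun φ => φ.f (n + 1)) (g.naturality a)
    refine (biprod.map_fst_assoc _ _ _).trans ?_
    refine Eq.trans ?_ (Category.assoc _ _ _).symm
    exact congrArg (biprod.fst ≫ ·) this

variable [(HomologicalComplex.quasiIso A (ComplexShape.down ℤ)).HasLocalization]

open HomologicalComplexUpToQuasiIso

/-- The homology map of a morphism of the derived category is an isomorphism. -/
abbrev IsIsoOnHomology {K L : ChainComplex A ℤ}
    (φ : (Q (C := A) (c := ComplexShape.down ℤ)).obj K ⟶ Q.obj L) (d : ℤ) : Prop :=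
  IsIso ((HomologicalComplexUpToQuasiIso.homologyFunctor A (ComplexShape.down ℤ) d).map φ)

lemma isIsoOnHomology_of_isIso {K L : ChainComplex A ℤ}
    (φ : (Q (C := A) (c := ComplexShape.down ℤ)).obj K ⟶ Q.obj L) [IsIso φ] (d : ℤ) :
    IsIsoOnHomology φ d :=
  inferInstance

lemma isIsoOnHomology_Q_map {K L : ChainComplex A ℤ} (φ : K ⟶ L) (d : ℤ)
    [IsIso (homologyMap φ d)] : IsIsoOnHomology (Q.map φ) d :=
  (NatIso.isIso_map_iff (homologyFunctorFactors A (ComplexShape.down ℤ) d) φ).2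
    (inferInstanceAs (IsIso (homologyMap φ d)))

/-- The natural connecting morphism `M[1] ⟶ K` in the derived category attached to natural short
exact sequences `0 ⟶ K ⟶ L ⟶ M ⟶ 0` of chain complexes. -/
lemma exists_connecting (f : F ⟶ G) (g : G ⟶ H) (w : f ≫ g = 0)
    (hS : ∀ X, (ShortComplex.mk (f.app X) (g.app X)
      (by rw [← NatTrans.comp_app, w]; rfl)).ShortExact) :
    ∃ δ : H ⋙ MultiPers.chainShift A 1 ⋙ Q ⟶ F ⋙ Q, ∀ X,
      (∀ d, (G.obj X).ExactAt d → (G.obj X).ExactAt (d + 1) → IsIsoOnHomology (δ.app X) d) ∧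
      ((∀ d, (G.obj X).ExactAt d) → IsIso (δ.app X)) := by
  let q := Functor.whiskerRight (coneFunctorDesc f g w)
    (Q (C := A) (c := ComplexShape.down ℤ))
  let p := Functor.whiskerRight (coneFunctorSnd f) (Q (C := A) (c := ComplexShape.down ℤ))
  -- The zigzag M[1] ← cone → K is strictly natural at the level of complexes, so inverting its left
  -- leg after localization keeps naturality.
  have hq : ∀ X, IsIso (q.app X) := fun X =>
    (isIso_Q_map_iff_mem_quasiIso _).2 (quasiIso_coneDesc _ _ _ (hS X))
  have : IsIso q := NatIso.isIso_of_isIso_app q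
  refine ⟨inv q ≫ p, fun X => ⟨fun d h₀ h₁ => ?_, fun h => ?_⟩⟩
  · have := isIso_homologyMap_coneSnd (f.app X) d h₀ h₁
    have : IsIsoOnHomology (p.app X) d := isIsoOnHomology_Q_map (coneSnd (f.app X)) d
    rw [IsIsoOnHomology, NatTrans.comp_app, Functor.map_comp]
    infer_instance
  · have : IsIso (p.app X) := (isIso_Q_map_iff_mem_quasiIso _).2
      ⟨fun d => (quasiIsoAt_iff_isIso_homologyMap _ _).2
        (isIso_homologyMap_coneSnd (f.app X) d (h d) (h (d + 1)))⟩
    rw [NatTrans.comp_app]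
    infer_instance

end

/-! ### Iterated shifts -/

lemma chainShift_exactAt (i : ℤ) (K : ChainComplex A ℤ) (d : ℤ) (h : K.ExactAt (d + i)) :
    ((MultiPers.chainShift A i).obj K).ExactAt d :=
  (exactAt_iff_isZero_homology _ _).2
    (IsZero.of_iso ((exactAt_iff_isZero_homology _ _).1 h)
      (MultiPers.chainShiftHomologyIso i K d))

/-- The isomorphism `C[i][1] ≅ C[i+1]`. -/
def chainShiftSuccIso (A : Type*) [Category* A] [Abelian A] (i j : ℤ) (h : j = i + 1) :
    MultiPers.chainShift A i ⋙ MultiPers.chainShift A 1 ≅ MultiPers.chainShift A j :=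
  NatIso.ofComponents (fun K => Hom.isoOfComponents
    (fun n => K.XIsoOfEq (by lia : n + 1 + i = n + j)) (fun a b hab => by
      subst h
      dsimp [MultiPers.chainShift]
      simp [Int.negOnePow_succ, Linear.units_smul_comp, Linear.comp_units_smul]))
    (fun φ => by
      ext n
      exact XIsoOfEq_hom_naturality φ (by lia))

/-- The isomorphism `C[0] ≅ C`. -/
def chainShiftZeroIso (A : Type*) [Category* A] [Abelian A] (i : ℤ) (h : i = 0) :
    MultiPers.chainShift A i ≅ 𝟭 _ :=
  NatIso.ofComponents (fun K => Hom.isoOfComponents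
    (fun n => K.XIsoOfEq (by lia : n + i = n)) (fun a b hab => by
      subst h
      dsimp [MultiPers.chainShift]
      simp))
    (fun φ => by
      ext n
      exact XIsoOfEq_hom_naturality φ (by lia))

lemma chainShift_shortExact (i : ℤ) {K L M : ChainComplex A ℤ} (f : K ⟶ L) (g : L ⟶ M)
    (w : f ≫ g = 0) (w') (h : (ShortComplex.mk f g w).ShortExact) :
    (ShortComplex.mk ((MultiPers.chainShift A i).map f)
      ((MultiPers.chainShift A i).map g) w').ShortExact :=
  shortExact_of_degreewise_shortExact _ fun n =>
    (shortExact_iff_degreewise_shortExact _).1 h (n + i)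

/-- The shifted version of `exists_connecting`. -/
lemma exists_connecting_shift {D : Type*} [Category* D] {F G H : D ⥤ ChainComplex A ℤ}
    [(HomologicalComplex.quasiIso A (ComplexShape.down ℤ)).HasLocalization]
    (f : F ⟶ G) (g : G ⟶ H) (w : f ≫ g = 0)
    (hS : ∀ X, (ShortComplex.mk (f.app X) (g.app X)
      (by rw [← NatTrans.comp_app, w]; rfl)).ShortExact) (i j : ℤ) (hj : j = i + 1) :
    ∃ δ : H ⋙ MultiPers.chainShift A j ⋙ HomologicalComplexUpToQuasiIso.Q ⟶
        F ⋙ MultiPers.chainShift A i ⋙ HomologicalComplexUpToQuasiIso.Q, ∀ X,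
      (∀ d, (G.obj X).ExactAt (d + i) → (G.obj X).ExactAt (d + j) →
        IsIsoOnHomology (δ.app X) d) ∧
      ((∀ d, (G.obj X).ExactAt d) → IsIso (δ.app X)) := by
  have w' : Functor.whiskerRight f (MultiPers.chainShift A i) ≫
      Functor.whiskerRight g (MultiPers.chainShift A i) = 0 := by
    rw [← Functor.whiskerRight_comp, w]
    rfl
  obtain ⟨δ, hδ⟩ := exists_connecting (Functor.whiskerRight f (MultiPers.chainShift A i))
    (Functor.whiskerRight g (MultiPers.chainShift A i)) w'
    (fun X => chainShift_shortExact i _ _ _ _ (hS X))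
  let e := Functor.isoWhiskerLeft H (Functor.isoWhiskerRight (chainShiftSuccIso A i j hj)
    (HomologicalComplexUpToQuasiIso.Q (C := A) (c := ComplexShape.down ℤ)))
  refine ⟨e.inv ≫ δ, fun X => ⟨fun d h₀ h₁ => ?_, fun h => ?_⟩⟩
  · have := (hδ X).1 d (chainShift_exactAt _ _ _ h₀)
      (chainShift_exactAt _ _ _ (by convert h₁ using 1; lia))
    rw [IsIsoOnHomology, NatTrans.comp_app, Functor.map_comp]
    infer_instance
  · have := (hδ X).2 (fun d => chainShift_exactAt _ _ _ (h _))
    exact inferInstanceAs (IsIso (e.inv.app X ≫ δ.app X))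

end ChainCone

namespace MultiPers

variable {k : Type u} [Field k] {N : ℕ}

/-! ### Pointwise criteria for exactness -/

/-- Evaluation at a grade is exact and so commutes with homology. The version at a single grade is
needed because eventual vanishing gives information at some grades only. -/
lemma isZero_homology_obj_iff (S : ShortComplex (Pers k N)) (v : Grade N) :
    IsZero (S.homology.obj v) ↔ Function.Exact (S.f.app v).hom.hom (S.g.app v).hom.hom := by
  rw [(show S.homology.obj v ≅ _ from
    (S.mapHomologyIso ((evaluation (Grade N) (FGModuleCat.{u} k)).obj v)).symm).isZero_iff,
    ← ShortComplex.exact_iff_isZero_homology,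
    ← ShortComplex.exact_map_iff_of_faithful _ (forget₂ (FGModuleCat.{u} k) (ModuleCat.{u} k)),
    ShortComplex.ShortExact.moduleCat_exact_iff_function_exact]
  rfl

lemma exact_iff_pointwise (S : ShortComplex (Pers k N)) :
    S.Exact ↔ ∀ v, Function.Exact (S.f.app v).hom.hom (S.g.app v).hom.hom := by
  rw [ShortComplex.exact_iff_isZero_homology, Functor.isZero_iff]
  exact forall_congr' fun v => isZero_homology_obj_iff S v

lemma shortExact_of_pointwise (S : ShortComplex (Pers k N))
    (hf : ∀ v, Function.Injective (S.f.app v).hom.hom)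
    (hfg : ∀ v, Function.Exact (S.f.app v).hom.hom (S.g.app v).hom.hom)
    (hg : ∀ v, Function.Surjective (S.g.app v).hom.hom) : S.ShortExact where
  exact := (exact_iff_pointwise S).2 hfg
  mono_f := by
    have : ∀ v, Mono (S.f.app v) := fun v =>
      (forget₂ (FGModuleCat.{u} k) (ModuleCat.{u} k)).mono_of_mono_map
        ((ModuleCat.mono_iff_injective _).2 (hf v))
    exact NatTrans.mono_of_mono_app _
  epi_g := by
    have : ∀ v, Epi (S.g.app v) := fun v =>
      (forget₂ (FGModuleCat.{u} k) (ModuleCat.{u} k)).epi_of_epi_map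
        ((ModuleCat.epi_iff_surjective _).2 (hg v))
    exact NatTrans.epi_of_epi_app _

/-! ### Free modules are projective -/

/-- The canonical generator of `F(z)`. -/
def freeGen (k : Type u) [Field k] (z : Grade N) : (freeOn k z).obj z :=
  (⟨1, by simp [freeComponent]⟩ : freeComponent k z z)

lemma eq_zero_of_mem_freeComponent {z v : Grade N} (h : ¬ z ≤ v) {x : k}
    (hx : x ∈ freeComponent k z v) : x = 0 := by
  simpa [freeComponent, h] using hx

open Classical in
/-- The morphism out of `F(z)` with a prescribed value at the generator. -/
def freeDesc {M : Pers k N} {z : Grade N} (m : M.obj z) : freeOn k z ⟶ M where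
  app v := FGModuleCat.ofHom (V := (freeComponent k z v)) (if h : z ≤ v then
    (LinearMap.toSpanSingleton k _ ((M.map (homOfLE h)).hom.hom m)).comp
      (freeComponent k z v).subtype else 0)
  naturality v v' f := by
    ext ⟨x, hx⟩
    by_cases h : z ≤ v
    · have h' := h.trans (leOfHom f)
      have e : (M.map f).hom.hom ((M.map (homOfLE h)).hom.hom m) =
          (M.map (homOfLE h')).hom.hom m :=
        congrArg (fun a : M.obj z ⟶ M.obj v' => a.hom.hom m)
          (M.map_comp (homOfLE h) f).symm
      rw [dif_pos h, dif_pos h']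
      refine Eq.trans ?_ ((M.map f).hom.hom.map_smul x _).symm
      rw [e]
      rfl
    · obtain rfl := eq_zero_of_mem_freeComponent h hx
      exact (LinearMap.map_zero ((freeOn k z).map f ≫ FGModuleCat.ofHom _).hom.hom).trans
        (LinearMap.map_zero (FGModuleCat.ofHom _ ≫ M.map f).hom.hom).symm

lemma freeDesc_app_self {M : Pers k N} {z : Grade N} (m : M.obj z) (x) :
    ((freeDesc m).app z).hom.hom x = (show freeComponent k z z from x).1 • m := by
  have e : (M.map (homOfLE (le_refl z))).hom.hom m = m :=
    congrArg (fun a : M.obj z ⟶ M.obj z => a.hom.hom m) (M.map_id z)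
  dsimp only [freeDesc]
  rw [dif_pos le_rfl, e]
  rfl

lemma freeDesc_app {M : Pers k N} {z v : Grade N} (h : z ≤ v) (m : M.obj z) (x) :
    ((freeDesc m).app v).hom.hom x =
      (show freeComponent k z v from x).1 • (M.map (homOfLE h)).hom.hom m := by
  dsimp only [freeDesc]
  rw [dif_pos h]
  rfl

/-- The Yoneda property of F(z): morphisms out of it are elements of M_z. -/
lemma eq_freeDesc {M : Pers k N} {z : Grade N} (f : freeOn k z ⟶ M) :
    f = freeDesc ((f.app z).hom.hom (freeGen k z)) := by
  refine freeOn_hom_ext fun x => ?_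
  rw [freeDesc_app_self, ← LinearMap.map_smul]
  congr 1
  exact Subtype.ext (mul_one _).symm

/-- Free modules of finite rank lift against pointwise surjections. -/
lemma exists_lift_of_free {L P P' : Pers k N} (hL : isFreeOfFiniteRank k N L) (p : P ⟶ P')
    (hp : ∀ v, Function.Surjective (p.app v).hom.hom) (f : L ⟶ P') : ∃ f', f' ≫ p = f := by
  obtain ⟨n, z, ⟨e⟩⟩ := hL
  have h : ∀ i, ∃ f' : freeOn k (z i) ⟶ P, f' ≫ p = biproduct.ι _ i ≫ e.hom ≫ f := fun i => by
    obtain ⟨m, hm⟩ := hp (z i) (((biproduct.ι _ i ≫ e.hom ≫ f).app (z i)).hom.hom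
      (freeGen k (z i)))
    refine ⟨freeDesc m, ?_⟩
    rw [eq_freeDesc (biproduct.ι (fun i => freeOn k (z i)) i ≫ e.hom ≫ f), ← hm]
    refine freeOn_hom_ext fun x => ?_
    rw [freeDesc_app_self]
    refine (congrArg (p.app (z i)).hom.hom (freeDesc_app_self m x)).trans ?_
    exact LinearMap.map_smul _ _ _
  choose f' hf' using h
  refine ⟨e.inv ≫ biproduct.desc f', ?_⟩
  rw [← cancel_epi e.hom]
  refine biproduct.hom_ext' _ _ fun i => ?_
  simp [hf']

/-! ### The functors `M ↦ Hom(M, P)^*` -/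

instance (M : FreePers k N) (P : Pers k N) : Module.Finite k (M.obj ⟶ P) :=
  finite_hom_of_free M.property P

/-- The functor `M ↦ Hom(M, P)^*` on free modules of finite rank, where `Hom` denotes the internal
Hom. -/
def dualHom (P : Pers k N) : FreePers k N ⥤ Pers k N where
  obj M :=
    { obj := fun z => FGModuleCat.of k (Module.Dual k (M.obj ⟶ gradeShift P (-z)))
      map := fun f => FGModuleCat.ofHom
        (Linear.rightComp k M.obj (gradeShiftMap P (neg_le_neg (leOfHom f)))).dualMap
      map_id := fun z => by
        ext φ x
        refine congrArg (φ : Module.Dual k (M.obj ⟶ gradeShift P (-z))) ?_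
        change x ≫ gradeShiftMap P (le_refl (-z)) = x
        rw [gradeShiftMap_refl, Category.comp_id]
      map_comp := fun {a b c} f g => by
        ext φ x
        refine congrArg (φ : Module.Dual k (M.obj ⟶ gradeShift P (-a))) ?_
        change x ≫ gradeShiftMap P ((neg_le_neg (leOfHom g)).trans (neg_le_neg (leOfHom f))) =
          (x ≫ gradeShiftMap P (neg_le_neg (leOfHom g))) ≫
            gradeShiftMap P (neg_le_neg (leOfHom f))
        rw [gradeShiftMap_trans, Category.assoc] }
  map {M M'} f :=
    { app := fun z => FGModuleCat.ofHom (Linear.leftComp k (gradeShift P (-z)) f.hom).dualMap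
      naturality := fun a b g => by
        ext φ x
        exact congrArg (φ : Module.Dual k (M.obj ⟶ gradeShift P (-a)))
          (Category.assoc f.hom x _).symm }
  map_id M := by
    ext z φ x
    exact congrArg (φ : Module.Dual k (M.obj ⟶ gradeShift P (-z)))
      (Category.id_comp (X := M.obj) x)
  map_comp {L M M'} f g := by
    ext z φ x
    exact congrArg (φ : Module.Dual k (L.obj ⟶ gradeShift P (-z))) (Category.assoc f.hom g.hom x)

instance (P : Pers k N) : (dualHom P).Additive where
  map_add {X Y f g} := by
    ext z φ
    refine LinearMap.ext fun x => ?_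
    let ψ : Module.Dual k (X.obj ⟶ gradeShift P (-z)) := φ
    let x' : Y.obj ⟶ gradeShift P (-z) := x
    change ψ ((f.hom + g.hom) ≫ x') = ψ (f.hom ≫ x') + ψ (g.hom ≫ x')
    rw [Preadditive.add_comp]
    exact ψ.map_add _ _

/-- The graded shift of a morphism. -/
def gradeShiftHom {P P' : Pers k N} (η : P ⟶ P') (z : Grade N) :
    gradeShift P z ⟶ gradeShift P' z :=
  Functor.whiskerLeft (translate z) η

lemma gradeShiftHom_comp_map {P P' : Pers k N} (η : P ⟶ P') {z z' : Grade N} (h : z ≤ z') :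
    gradeShiftHom η z ≫ gradeShiftMap P' h = gradeShiftMap P h ≫ gradeShiftHom η z' := by
  ext1; funext v
  exact (η.naturality (homOfLE (add_le_add_left h v))).symm

/-- The functoriality of `Hom(M, P)^*` in `P`. -/
def dualHomMap {P P' : Pers k N} (η : P ⟶ P') : dualHom P' ⟶ dualHom P where
  app M :=
    { app := fun z => FGModuleCat.ofHom (Linear.rightComp k M.obj (gradeShiftHom η (-z))).dualMap
      naturality := fun a b g => by
        ext φ
        refine LinearMap.ext fun (x : M.obj ⟶ gradeShift P (-b)) => ?_
        refine congrArg (show Module.Dual k (M.obj ⟶ gradeShift P' (-a)) from φ) ?_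
        change (x ≫ gradeShiftHom η (-b)) ≫ gradeShiftMap P' (neg_le_neg (leOfHom g)) =
          (x ≫ gradeShiftMap P (neg_le_neg (leOfHom g))) ≫ gradeShiftHom η (-a)
        rw [Category.assoc, Category.assoc, gradeShiftHom_comp_map] }
  naturality L M f := by
    ext z φ
    exact LinearMap.ext fun (x : M.obj ⟶ gradeShift P (-z)) =>
      congrArg (show Module.Dual k (L.obj ⟶ gradeShift P' (-z)) from φ)
        (Category.assoc f.hom x (gradeShiftHom η (-z))).symm

lemma dualHomMap_id (P : Pers k N) : dualHomMap (𝟙 P) = 𝟙 (dualHom P) := by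
  ext M z φ
  exact LinearMap.ext fun (x : M.obj ⟶ gradeShift P (-z)) =>
    congrArg (show Module.Dual k (M.obj ⟶ gradeShift P (-z)) from φ) (Category.comp_id x)

lemma dualHomMap_comp {P P' P'' : Pers k N} (η : P ⟶ P') (θ : P' ⟶ P'') :
    dualHomMap (η ≫ θ) = dualHomMap θ ≫ dualHomMap η := by
  ext M z φ
  exact LinearMap.ext fun (x : M.obj ⟶ gradeShift P (-z)) =>
    congrArg (show Module.Dual k (M.obj ⟶ gradeShift P'' (-z)) from φ) (Category.assoc x (gradeShiftHom η (-z)) (gradeShiftHom θ (-z))).symm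

/-- An isomorphism `P ≅ P'` induces an isomorphism of the functors `Hom(-, P)^*`. -/
def dualHomIso {P P' : Pers k N} (e : P ≅ P') : dualHom P' ≅ dualHom P where
  hom := dualHomMap e.hom
  inv := dualHomMap e.inv
  hom_inv_id := by rw [← dualHomMap_comp, e.inv_hom_id, dualHomMap_id]
  inv_hom_id := by rw [← dualHomMap_comp, e.hom_inv_id, dualHomMap_id]

/-- The Nakayama functor is `Hom(-, F(𝟏))^*`. -/
def nakayamaIso (k : Type u) [Field k] (N : ℕ) :
    nakayama k N ≅ dualHom (freeOn k (Grade.ones N)) :=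
  NatIso.ofComponents (fun _ => NatIso.ofComponents (fun _ => Iso.refl _) (fun _ => rfl))
    (fun _ => rfl)

lemma dualHomMap_comp_zero {P P' P'' : Pers k N} (η : P ⟶ P') (θ : P' ⟶ P'') (w : η ≫ θ = 0) :
    dualHomMap θ ≫ dualHomMap η = 0 := by
  rw [← dualHomMap_comp, w]
  ext M z φ
  exact LinearMap.ext fun (x : M.obj ⟶ gradeShift P (-z)) =>
    (congrArg (show Module.Dual k (M.obj ⟶ gradeShift P'' (-z)) from φ)
      (comp_zero : x ≫ (0 : gradeShift P (-z) ⟶ gradeShift P'' (-z)) = 0)).trans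
        (LinearMap.map_zero _)

lemma _root_.Function.Exact.dualMap {K V₁ V₂ V₃ : Type*} [Field K] [AddCommGroup V₁]
    [AddCommGroup V₂] [AddCommGroup V₃] [Module K V₁] [Module K V₂] [Module K V₃]
    {f : V₁ →ₗ[K] V₂} {g : V₂ →ₗ[K] V₃} (h : Function.Exact f g) :
    Function.Exact g.dualMap f.dualMap := by
  rw [LinearMap.exact_iff, LinearMap.range_dualMap_eq_dualAnnihilator_ker,
    LinearMap.ker_dualMap_eq_dualAnnihilator_range, h.linearMap_ker_eq]

/-- Hom(M, -) is left exact, and right exact because `M` is free; dualizing over a field then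
reverses the sequence. -/
lemma dualHom_shortExact {P P' P'' : Pers k N} (η : P ⟶ P') (θ : P' ⟶ P'') (w : η ≫ θ = 0)
    (hη : ∀ v, Function.Injective (η.app v).hom.hom)
    (hηθ : ∀ v, Function.Exact (η.app v).hom.hom (θ.app v).hom.hom)
    (hθ : ∀ v, Function.Surjective (θ.app v).hom.hom) (M : FreePers k N) (w') :
    (ShortComplex.mk ((dualHomMap θ).app M) ((dualHomMap η).app M) w').ShortExact := by
  have key : ∀ z : Grade N, Function.Injective (Linear.rightComp k M.obj (gradeShiftHom η z)) ∧
      Function.Exact (Linear.rightComp k M.obj (gradeShiftHom η z))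
        (Linear.rightComp k M.obj (gradeShiftHom θ z)) ∧
      Function.Surjective (Linear.rightComp k M.obj (gradeShiftHom θ z)) := fun z => by
    have wz : gradeShiftHom η z ≫ gradeShiftHom θ z = 0 :=
      congrArg (Functor.whiskerLeft (translate z)) w
    have hS := shortExact_of_pointwise (ShortComplex.mk _ _ wz) (fun v => hη (z + v))
      (fun v => hηθ (z + v)) (fun v => hθ (z + v))
    have := hS.mono_f
    refine ⟨fun f g h => ?_, fun f => ⟨fun h => ?_, ?_⟩, fun f => ?_⟩
    · exact (cancel_mono (gradeShiftHom η z)).1 h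
    · exact ⟨hS.exact.lift f h, hS.exact.lift_f f h⟩
    · rintro ⟨g, rfl⟩
      change (g ≫ gradeShiftHom η z) ≫ gradeShiftHom θ z = 0
      rw [Category.assoc, wz, comp_zero]
    · exact exists_lift_of_free M.property (gradeShiftHom θ z) (fun v => hθ (z + v)) f
  refine shortExact_of_pointwise _ (fun z => ?_) (fun z => ?_) (fun z => ?_)
  · exact LinearMap.dualMap_injective_iff.2 (key (-z)).2.2
  · exact (key (-z)).2.1.dualMap
  · exact LinearMap.dualMap_surjective_iff.2 (key (-z)).1

/-! ### Interval modules -/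

/-- The component at `w` of the interval module on `R`. -/
def intervalComponent (k : Type u) [Field k] (R : Set (Grade N)) (w : Grade N) :
    Submodule k k where
  carrier := {x | w ∉ R → x = 0}
  add_mem' ha hb h := by rw [ha h, hb h, add_zero]
  zero_mem' _ := rfl
  smul_mem' c x hx h := by rw [hx h, smul_zero]

open Classical in
/-- The map between components of interval modules that is the identity wherever possible. -/
def intervalCut (k : Type u) [Field k] (R R' : Set (Grade N)) (w w' : Grade N) :
    intervalComponent k R w →ₗ[k] intervalComponent k R' w' where
  toFun x := ⟨if w' ∈ R' then x.1 else 0, fun h => if_neg h⟩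
  map_add' x y := Subtype.ext (by dsimp; split_ifs <;> simp)
  map_smul' c x := Subtype.ext (by dsimp; split_ifs <;> simp)

lemma intervalCut_of_mem {R R' : Set (Grade N)} {w w' : Grade N} (h : w' ∈ R')
    (x : intervalComponent k R w) : (intervalCut k R R' w w' x).1 = x.1 := if_pos h

lemma intervalCut_of_notMem {R R' : Set (Grade N)} {w w' : Grade N} (h : w' ∉ R')
    (x : intervalComponent k R w) : intervalCut k R R' w w' x = 0 := Subtype.ext (if_neg h)

/-- The middle grade matters only when both ends lie in their sets; otherwise the source or the
target is zero. This gives both functoriality of interval modules and naturality of the maps between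
them. -/
lemma intervalCut_intervalCut {R R' R'' : Set (Grade N)} {a b c : Grade N}
    (h : a ∈ R → c ∈ R'' → b ∈ R') (x : intervalComponent k R a) :
    intervalCut k R' R'' b c (intervalCut k R R' a b x) = intervalCut k R R'' a c x := by
  by_cases hc : c ∈ R''
  · refine Subtype.ext ?_
    rw [intervalCut_of_mem hc, intervalCut_of_mem hc]
    by_cases hb : b ∈ R'
    · rw [intervalCut_of_mem hb]
    · rw [intervalCut_of_notMem hb, x.2 fun ha => hb (h ha hc)]
      rfl
  · rw [intervalCut_of_notMem hc, intervalCut_of_notMem hc]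

/-- The interval module on a convex set `R` of grades. -/
def interval (k : Type u) [Field k] (R : Set (Grade N)) (hR : R.OrdConnected) : Pers k N where
  obj w := FGModuleCat.of k (intervalComponent k R w)
  map {w w'} _ := FGModuleCat.ofHom (intervalCut k R R w w')
  map_id w := by
    ext x
    by_cases h : w ∈ R
    · exact intervalCut_of_mem h x
    · exact congrArg Subtype.val ((intervalCut_of_notMem h x).trans (Subtype.ext (x.2 h).symm))
  map_comp f g := by
    ext x
    exact congrArg Subtype.val
      (intervalCut_intervalCut (fun ha hc => hR.out ha hc ⟨leOfHom f, leOfHom g⟩) x).symm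

/-- The natural map between interval modules on compatible convex sets. -/
def intervalMap (k : Type u) [Field k] {R R' : Set (Grade N)} (hR : R.OrdConnected)
    (hR' : R'.OrdConnected)
    (h : ∀ w w', w ≤ w' → w ∈ R → w' ∈ R' → w' ∈ R ∧ w ∈ R') :
    interval k R hR ⟶ interval k R' hR' where
  app w := FGModuleCat.ofHom (intervalCut k R R' w w)
  naturality a b f := by
    ext x : 3
    exact (intervalCut_intervalCut (fun ha hb => (h a b (leOfHom f) ha hb).1) x).trans
      (intervalCut_intervalCut (fun ha hb => (h a b (leOfHom f) ha hb).2) x).symm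

/-- The grades that are positive in the coordinates from `A` and non-positive in those from
`B`. -/
def region (A B : Finset (Fin N)) : Set (Grade N) :=
  {w | (∀ i ∈ A, (1 : ℤ) ≤ w i) ∧ ∀ i ∈ B, w i ≤ (0 : ℤ)}

lemma ordConnected_region (A B : Finset (Fin N)) : (region A B).OrdConnected :=
  ⟨fun _ ha _ hc _ hb => ⟨fun i hi => (ha.1 i hi).trans (hb.1 i),
    fun i hi => (hb.2 i).trans (hc.2 i hi)⟩⟩

/-- The interval module on `region A B`. -/
abbrev box (k : Type u) [Field k] (A B : Finset (Fin N)) : Pers k N :=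
  interval k (region A B) (ordConnected_region A B)

lemma mem_region_insert_left {A B : Finset (Fin N)} {i : Fin N} {w : Grade N} :
    w ∈ region (insert i A) B ↔ w ∈ region A B ∧ (1 : ℤ) ≤ w i := by
  simp only [region, Set.mem_ofPred_eq, Finset.forall_mem_insert]
  tauto

lemma mem_region_insert_right {A B : Finset (Fin N)} {i : Fin N} {w : Grade N} :
    w ∈ region A (insert i B) ↔ w ∈ region A B ∧ w i ≤ (0 : ℤ) := by
  simp only [region, Set.mem_ofPred_eq, Finset.forall_mem_insert]
  tauto

/-- The inclusion of the part of `box A B` that is positive in the coordinate `i`. -/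
def boxInsertLeft (k : Type u) [Field k] (A B : Finset (Fin N)) (i : Fin N) :
    box k (insert i A) B ⟶ box k A B :=
  intervalMap k _ _ fun w w' h hw hw' => by
    rw [mem_region_insert_left] at hw ⊢
    exact ⟨⟨hw', hw.2.trans (h i)⟩, hw.1⟩

/-- The projection of `box A B` onto the part that is non-positive in the coordinate `i`. -/
def boxInsertRight (k : Type u) [Field k] (A B : Finset (Fin N)) (i : Fin N) :
    box k A B ⟶ box k A (insert i B) :=
  intervalMap k _ _ fun w w' h hw hw' => by
    rw [mem_region_insert_right] at hw' ⊢
    exact ⟨hw'.1, hw, (h i).trans hw'.2⟩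

/-- Coordinate i of an integral grade is either ≥ 1 or ≤ 0, so region(A, B) is the disjoint union of
the two smaller regions. -/
lemma boxInsert_exact (A B : Finset (Fin N)) (i : Fin N) (v : Grade N) :
    Function.Injective ((boxInsertLeft k A B i).app v).hom.hom ∧
    Function.Exact ((boxInsertLeft k A B i).app v).hom.hom
      ((boxInsertRight k A B i).app v).hom.hom ∧
    Function.Surjective ((boxInsertRight k A B i).app v).hom.hom := by
  let R := region (insert i A) B
  let R' := region A B
  let R'' := region A (insert i B)
  have h₁ : v ∈ R → v ∈ R' := fun h => (mem_region_insert_left.1 h).1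
  have h₂ : v ∈ R'' → v ∈ R' := fun h => (mem_region_insert_right.1 h).1
  have h₃ : v ∈ R → v ∉ R'' := fun h h' => by
    have a := (mem_region_insert_left.1 h).2
    have b := (mem_region_insert_right.1 h').2
    lia
  have h₄ : v ∈ R' → v ∉ R'' → v ∈ R := fun h h' => by
    refine mem_region_insert_left.2 ⟨h, ?_⟩
    by_contra hv
    exact h' (mem_region_insert_right.2 ⟨h, by lia⟩)
  change Function.Injective (intervalCut k R R' v v) ∧
    Function.Exact (intervalCut k R R' v v) (intervalCut k R' R'' v v) ∧
    Function.Surjective (intervalCut k R' R'' v v)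
  refine ⟨?_, fun x => ⟨fun h => ?_, ?_⟩, fun y => ?_⟩
  · rw [injective_iff_map_eq_zero]
    intro x hx
    refine Subtype.ext ?_
    by_cases h : v ∈ R
    · rw [← intervalCut_of_mem (h₁ h) x, hx]
      rfl
    · exact x.2 h
  · by_cases hv : v ∈ R'
    · refine ⟨⟨x.1, fun hR => ?_⟩, Subtype.ext (intervalCut_of_mem hv _)⟩
      have hR'' : v ∈ R'' := by_contra fun h'' => hR (h₄ hv h'')
      rw [← intervalCut_of_mem hR'' x, h]
      rfl
    · exact ⟨0, (map_zero _).trans (Subtype.ext (x.2 hv).symm)⟩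
  · rintro ⟨x, rfl⟩
    by_cases h : v ∈ R
    · exact intervalCut_of_notMem (h₃ h) _
    · obtain rfl : x = 0 := Subtype.ext (x.2 h)
      rw [map_zero, map_zero]
  · by_cases h : v ∈ R''
    · exact ⟨⟨y.1, fun h' => (h' (h₂ h)).elim⟩, Subtype.ext (intervalCut_of_mem h _)⟩
    · exact ⟨0, (map_zero _).trans (Subtype.ext (y.2 h).symm)⟩

lemma boxInsert_zero (A B : Finset (Fin N)) (i : Fin N) :
    boxInsertLeft k A B i ≫ boxInsertRight k A B i = 0 := by
  ext v x : 4
  exact ((boxInsert_exact A B i v).2.1 _).2 ⟨x, rfl⟩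

/-- The box of positive grades is `F(𝟏)`. -/
def boxUnivIso (k : Type u) [Field k] (N : ℕ) :
    box k (Finset.univ : Finset (Fin N)) ∅ ≅ freeOn k (Grade.ones N) :=
  have hmem : ∀ v : Grade N, v ∈ region Finset.univ ∅ ↔ Grade.ones N ≤ v := fun v => by
    simp only [region, Set.mem_ofPred_eq, Finset.mem_univ, Finset.notMem_empty, true_implies,
      false_implies, implies_true, and_true]
    rfl
  have heq : ∀ v : Grade N,
      intervalComponent k (region Finset.univ ∅) v = freeComponent k (Grade.ones N) v :=
    fun v => by
      ext x
      by_cases h : Grade.ones N ≤ v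
      · simp [intervalComponent, freeComponent, hmem, h]
      · simp [intervalComponent, freeComponent, hmem, h]
  NatIso.ofComponents (fun v => (LinearEquiv.ofEq _ _ (heq v)).toFGModuleCatIso)
    (fun {v v'} f => by
      ext x : 3
      refine Subtype.ext ?_
      change (intervalCut k (region Finset.univ ∅) (region Finset.univ ∅) v v' x).1 = x.1
      by_cases h : v ∈ region Finset.univ ∅
      · exact intervalCut_of_mem ((hmem _).2 (((hmem _).1 h).trans (leOfHom f))) x
      · have h0 : x = (0 : intervalComponent k (region Finset.univ ∅) v) :=
          Subtype.ext (x.2 h)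
        exact (congrArg (fun y => (intervalCut k (region Finset.univ ∅) (region Finset.univ ∅)
          v v' y).1) h0).trans ((congrArg Subtype.val (map_zero _)).trans
            (congrArg Subtype.val h0).symm))

/-! ### The evaluation map -/

/-- The value at a point `x` of morphisms out of `M`. -/
def valueAt {M : Pers k N} (M' : Pers k N) {w : Grade N} (x : M.obj w) :
    (M ⟶ M') →ₗ[k] M'.obj w where
  toFun f := (f.app w).hom.hom x
  map_add' _ _ := rfl
  map_smul' _ _ := rfl

/-- The evaluation map `M_w ⟶ Hom(M, k_R⟨z⟩)^*` for an interval module `k_R`. -/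
def evalDual (M : Pers k N) {R : Set (Grade N)} (hR : R.OrdConnected) (z w : Grade N) :
    M.obj w →ₗ[k] Module.Dual k (M ⟶ gradeShift (interval k R hR) z) where
  toFun x := (intervalComponent k R (z + w)).subtype ∘ₗ valueAt (gradeShift (interval k R hR) z) x
  map_add' x y := LinearMap.ext fun f =>
    congrArg (intervalComponent k R (z + w)).subtype ((f.app w).hom.hom.map_add x y)
  map_smul' c x := LinearMap.ext fun f =>
    congrArg (intervalComponent k R (z + w)).subtype ((f.app w).hom.hom.map_smul c x)

lemma evalDual_naturality {M M' : Pers k N} (g : M ⟶ M') {R : Set (Grade N)}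
    (hR : R.OrdConnected) (z w : Grade N) (x : M.obj w)
    (f : M' ⟶ gradeShift (interval k R hR) z) :
    evalDual M' hR z w ((g.app w).hom.hom x) f = evalDual M hR z w x (g ≫ f) := rfl

lemma freeDesc_smul {M : Pers k N} {z : Grade N} (c : k) (m : M.obj z) :
    freeDesc (c • m) = c • freeDesc m := by
  refine freeOn_hom_ext fun x => ?_
  refine (freeDesc_app_self _ _).trans ?_
  refine Eq.trans ?_ (congrArg (c • ·) (freeDesc_app_self m x).symm)
  exact smul_comm _ _ _

/-- Under these hypotheses g ≤ w holds exactly when z + g lies in the region of non-positive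
coordinates in `B`. So F(g)_w and Hom(F(g), k_{∅,B}⟨z⟩) are both one-dimensional or both zero. -/
lemma evalDual_freeOn_bijective {B : Finset (Fin N)} {z w g : Grade N}
    (hB : ∀ i ∈ B, z i + w i = 0) (hg : ∀ i, i ∉ B → g i ≤ w i) :
    Function.Bijective (evalDual (freeOn k g) (ordConnected_region ∅ B) z w) := by
  have hw : z + w ∈ region ∅ B := ⟨fun i hi => by simp at hi, fun i hi => (hB i hi).le⟩
  by_cases h : g ≤ w
  · have hzg : z + g ∈ region ∅ B := ⟨fun i hi => by simp at hi, fun i hi =>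
      (add_le_add_right (h i) (z i)).trans (hB i hi).le⟩
    let one : intervalComponent k (region ∅ B) (z + g) := ⟨1, fun h => (h hzg).elim⟩
    -- This morphism spans the Hom space, and evaluation against it reads off the coordinate of an
    -- element of F(g)_w.
    let f₀ : freeOn k g ⟶ gradeShift (box k ∅ B) z :=
      freeDesc (M := gradeShift (box k ∅ B) z) (z := g) one
    have hf₀ : ∀ x : freeComponent k g w,
        evalDual (freeOn k g) (ordConnected_region ∅ B) z w x f₀ = x.1 := fun x => by
      refine (congrArg Subtype.val (freeDesc_app (M := gradeShift (box k ∅ B) z) h one x)).trans ?_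
      refine (congrArg (x.1 • ·) (intervalCut_of_mem hw one)).trans ?_
      exact mul_one _
    constructor
    · rw [injective_iff_map_eq_zero]
      intro x hx
      refine Subtype.ext ((hf₀ x).symm.trans ?_)
      rw [hx]
      rfl
    · intro ξ
      refine ⟨(⟨ξ f₀, by simp [freeComponent, h]⟩ : freeComponent k g w),
        LinearMap.ext fun f => ?_⟩
      let m : intervalComponent k (region ∅ B) (z + g) := (f.app g).hom.hom (freeGen k g)
      have hm : m = m.1 • one := Subtype.ext (mul_one _).symm
      have hf : f = m.1 • f₀ := (eq_freeDesc f).trans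
        ((congrArg (freeDesc (M := gradeShift (box k ∅ B) z) (z := g)) hm).trans
          (freeDesc_smul _ _))
      rw [hf, LinearMap.map_smul, LinearMap.map_smul, hf₀]
  · obtain ⟨i, hi⟩ : ∃ i, ¬ g i ≤ w i := not_forall.1 h
    -- The inequality g ≤ w can fail only in a coordinate of `B`, where it forces z + g to be
    -- positive.
    have hiB : i ∈ B := by_contra fun h' => hi (hg i h')
    have hzg : z + g ∉ region ∅ B := fun h' => by
      have h1 : z i + g i ≤ 0 := h'.2 i hiB
      have h2 := hB i hiB
      lia
    have hf : ∀ f : freeOn k g ⟶ gradeShift (box k ∅ B) z, f = 0 := fun f => by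
      let m : intervalComponent k (region ∅ B) (z + g) := (f.app g).hom.hom (freeGen k g)
      have hm : m = (0 : k) • m := Subtype.ext ((m.2 hzg).trans (zero_mul _).symm)
      exact (eq_freeDesc f).trans
        ((congrArg (freeDesc (M := gradeShift (box k ∅ B) z) (z := g)) hm).trans
          ((freeDesc_smul _ _).trans (zero_smul _ _)))
    constructor
    · intro x y _
      exact Subtype.ext ((eq_zero_of_mem_freeComponent h x.2).trans
        (eq_zero_of_mem_freeComponent h y.2).symm)
    · intro ξ
      refine ⟨0, LinearMap.ext fun f => ?_⟩
      rw [hf f]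
      exact (LinearMap.map_zero _).trans (LinearMap.map_zero ξ).symm

/-- Evaluation is natural in the module and both sides are additive, so a decomposition of the
identity suffices; orthogonality of the pieces plays no role. -/
lemma evalDual_bijective_of_retracts {L : Pers k N} {R : Set (Grade N)} (hR : R.OrdConnected)
    (z w : Grade N) {ι : Type*} [Fintype ι] {X : ι → Pers k N} (r : ∀ i, L ⟶ X i)
    (s : ∀ i, X i ⟶ L) (hrs : ∑ i, r i ≫ s i = 𝟙 L)
    (h : ∀ i, Function.Bijective (evalDual (X i) hR z w)) :
    Function.Bijective (evalDual L hR z w) := by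
  have htot : ∀ x : L.obj w, x = ∑ i, ((s i).app w).hom.hom (((r i).app w).hom.hom x) :=
    fun x => by
      have := congrArg (valueAt L x) hrs
      rw [map_sum] at this
      exact this.symm
  constructor
  · rw [injective_iff_map_eq_zero]
    intro x hx
    have hr : ∀ i, ((r i).app w).hom.hom x = 0 := fun i =>
      (injective_iff_map_eq_zero _).1 (h i).1 _ (LinearMap.ext fun f => by
        rw [evalDual_naturality, hx]
        rfl)
    rw [htot x]
    exact Finset.sum_eq_zero fun i _ => by rw [hr i, map_zero]
  · intro ξ
    choose x hx using fun i => (h i).2 (ξ ∘ₗ Linear.leftComp k _ (r i))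
    refine ⟨∑ i, ((s i).app w).hom.hom (x i), LinearMap.ext fun f => ?_⟩
    rw [map_sum, LinearMap.sum_apply]
    have : ∀ i, evalDual L hR z w (((s i).app w).hom.hom (x i)) f = ξ ((r i ≫ s i) ≫ f) :=
      fun i => by
        rw [evalDual_naturality, hx, Category.assoc]
        rfl
    simp only [this]
    rw [← map_sum, ← Preadditive.sum_comp, hrs, Category.id_comp]

/-- Beyond the grades of all generators, the coordinates outside `B` no longer constrain anything.
The bound depends on `L` alone. -/
lemma evalDual_bijective {L : Pers k N} (hL : isFreeOfFiniteRank k N L) :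
    ∃ b : Grade N, ∀ (B : Finset (Fin N)) (z w : Grade N), (∀ i ∈ B, z i + w i = 0) →
      (∀ i, i ∉ B → b i ≤ w i) →
      Function.Bijective (evalDual L (ordConnected_region ∅ B) z w) := by
  obtain ⟨n, g, ⟨e⟩⟩ := hL
  -- Any common upper bound of the generators would do; a sum of absolute values needs no case
  -- distinction for rank zero.
  refine ⟨fun i => ∑ j, |g j i|, fun B z w hB hb => ?_⟩
  refine evalDual_bijective_of_retracts _ z w
    (X := fun j => freeOn k (g j)) (fun j => e.inv ≫ biproduct.π _ j)
    (fun j => biproduct.ι (fun j => freeOn k (g j)) j ≫ e.hom) ?_ fun j => evalDual_freeOn_bijective hB fun i hi => ?_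
  · have : ∀ j, (e.inv ≫ biproduct.π (fun j => freeOn k (g j)) j) ≫
        biproduct.ι (fun j => freeOn k (g j)) j ≫ e.hom =
        e.inv ≫ (biproduct.π (fun j => freeOn k (g j)) j ≫
          biproduct.ι (fun j => freeOn k (g j)) j) ≫ e.hom := fun j => by
      simp only [Category.assoc]
    simp only [this]
    rw [← Preadditive.comp_sum, ← Preadditive.sum_comp, biproduct.total, Category.id_comp,
      e.inv_hom_id]
  · refine le_trans ?_ (hb i hi)
    exact (le_abs_self _).trans
      (Finset.single_le_sum (f := fun j => |g j i|) (fun _ _ => abs_nonneg _)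
        (Finset.mem_univ j))

/-- The functor `M ↦ Hom(M, k_{A,B})^*` for the interval module of a region. -/
abbrev boxDual (k : Type u) [Field k] (A B : Finset (Fin N)) : FreePers k N ⥤ Pers k N :=
  dualHom (box k A B)

/-- For `A = ∅` and `B` everything, the functor `boxDual` is the inclusion. -/
def boxDualUnivIso (k : Type u) [Field k] (N : ℕ) :
    (isFreeOfFiniteRank k N).ι ≅ boxDual k (∅ : Finset (Fin N)) Finset.univ :=
  NatIso.ofComponents (fun M => NatIso.ofComponents
    (fun z => (LinearEquiv.ofBijective (evalDual M.obj (ordConnected_region ∅ Finset.univ) (-z) z)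
      ((evalDual_bijective M.property).choose_spec Finset.univ (-z) z
        (fun i _ => neg_add_cancel (z i)) (fun i hi => (hi (Finset.mem_univ i)).elim)
        )).toFGModuleCatIso)
    (fun {a b} f => by
      ext x
      refine LinearMap.ext fun (φ : M.obj ⟶ gradeShift (box k ∅ Finset.univ) (-b)) => ?_
      -- Evaluation always takes place at grade 0, which lies in the region, so the structure map
      -- between the two values is the identity of `k`.
      have h0 : ∀ c : Grade N, -c + c ∈ region (∅ : Finset (Fin N)) Finset.univ := fun c =>
        ⟨fun i hi => by simp at hi, fun i _ => (neg_add_cancel (c i)).le⟩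
      let y : intervalComponent k (region ∅ Finset.univ) (-b + a) := (φ.app a).hom.hom x
      have e₁ : ((φ.app b).hom.hom ((M.obj.map f).hom.hom x)) =
          intervalCut k (region ∅ Finset.univ) (region ∅ Finset.univ) (-b + a) (-b + b) y :=
        congrArg (fun m : M.obj.obj a ⟶ (gradeShift (box k ∅ Finset.univ) (-b)).obj b =>
          m.hom.hom x) (φ.naturality f)
      refine (congrArg Subtype.val e₁).trans ((intervalCut_of_mem (h0 b) y).trans ?_)
      exact (intervalCut_of_mem (R := region ∅ Finset.univ) (h0 a) y).symm))
    (fun _ => rfl)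

/-! ### Vanishing of the homology of box duals -/

/-- The functor `boxDual`, applied degreewise to chain complexes. -/
abbrev boxComplex (k : Type u) [Field k] (A B : Finset (Fin N)) :
    ChainComplex (FreePers k N) ℤ ⥤ ChainComplex (Pers k N) ℤ :=
  (boxDual k A B).mapHomologicalComplex (ComplexShape.down ℤ)

lemma _root_.Function.Exact.of_bijective_ladder {R V₁ V₂ V₃ W₁ W₂ W₃ : Type*} [Semiring R]
    [AddCommMonoid V₁] [AddCommMonoid V₂] [AddCommMonoid V₃] [AddCommMonoid W₁]
    [AddCommMonoid W₂] [AddCommMonoid W₃] [Module R V₁] [Module R V₂] [Module R V₃] [Module R W₁]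
    [Module R W₂] [Module R W₃] {f : V₁ → V₂} {g : V₂ → V₃} {f' : W₁ → W₂} {g' : W₂ → W₃}
    (e₁ : V₁ →ₗ[R] W₁) (e₂ : V₂ →ₗ[R] W₂) (e₃ : V₃ →ₗ[R] W₃) (h₁ : Function.Surjective e₁)
    (h₂ : Function.Bijective e₂) (h₃ : Function.Injective e₃)
    (hf : ∀ x, f' (e₁ x) = e₂ (f x)) (hg : ∀ x, g' (e₂ x) = e₃ (g x))
    (h : Function.Exact f g) : Function.Exact f' g' := by
  intro y
  obtain ⟨x, rfl⟩ := h₂.2 y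
  rw [hg, map_eq_zero_iff e₃ h₃, h x]
  constructor
  · rintro ⟨a, rfl⟩
    exact ⟨e₁ a, hf a⟩
  · rintro ⟨b, hb⟩
    obtain ⟨a, rfl⟩ := h₁ b
    exact ⟨a, h₂.1 (by rw [← hb, hf])⟩

lemma isZero_of_not_nontrivial {V : FGModuleCat.{u} k} (h : ¬ Nontrivial V) : IsZero V := by
  rw [IsZero.iff_id_eq_zero]
  ext x
  have := not_nontrivial_iff_subsingleton.1 h
  exact Subsingleton.elim (α := V) _ _

/-- In grade v the three relevant terms are identified by evaluation with those of `C` in one grade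
w outside the support of H_q(C). -/
lemma boxComplex_exactAt_of_empty {B : Finset (Fin N)} (hB : B ≠ Finset.univ)
    (C : ChainComplex (FreePers k N) ℤ) (q : ℤ)
    (h : EventuallyVanishes (((forgetFree k N).obj C).homology q)) :
    ((boxComplex k ∅ B).obj C).ExactAt q := by
  obtain ⟨i₀, hi₀⟩ : ∃ i, i ∉ B := by
    by_contra! h'
    exact hB (Finset.eq_univ_of_forall h')
  obtain ⟨c, hc⟩ := h
  choose b hb using fun n => evalDual_bijective (C.X n).property
  refine (exact_iff_pointwise _).2 fun v => ?_
  let p := (ComplexShape.down ℤ).prev q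
  let n := (ComplexShape.down ℤ).next q
  -- On `B` evaluation requires w = v. Elsewhere w must exceed the bounds of the three free modules
  -- involved, and also c, so that a coordinate outside `B` certifies that w ≤ c fails.
  let w : Grade N := fun i =>
    if i ∈ B then v i else max (c i + 1) (max (b p i) (max (b q i) (b n i)))
  have hwB : ∀ i ∈ B, (-v) i + w i = 0 := fun i hi => by
    have : w i = v i := if_pos hi
    rw [this]
    exact neg_add_cancel (v i)
  have hw : ∀ i, i ∉ B → w i = max (c i + 1) (max (b p i) (max (b q i) (b n i))) :=
    fun i hi => if_neg hi
  have hwc : ¬ w ≤ c := fun hle => by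
    have h1 := hle i₀
    rw [hw i₀ hi₀] at h1
    have h2 := (le_max_left _ _).trans h1
    lia
  have hex := (isZero_homology_obj_iff (((forgetFree k N).obj C).sc q) w).1
    (isZero_of_not_nontrivial fun hnt => hwc (hc hnt))
  exact Function.Exact.of_bijective_ladder (R := k)
    (f := ((C.d p q).hom.app w).hom.hom) (g := ((C.d q n).hom.app w).hom.hom)
    (f' := (Linear.leftComp k (gradeShift (box k ∅ B) (-v)) (C.d p q).hom).dualMap)
    (g' := (Linear.leftComp k (gradeShift (box k ∅ B) (-v)) (C.d q n).hom).dualMap)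
    (evalDual (C.X p).obj _ (-v) w) (evalDual (C.X q).obj _ (-v) w)
    (evalDual (C.X n).obj _ (-v) w)
    (hb p B (-v) w hwB fun i hi => by rw [hw i hi]; simp).2
    (hb q B (-v) w hwB fun i hi => by rw [hw i hi]; simp)
    (hb n B (-v) w hwB fun i hi => by rw [hw i hi]; simp).1
    (fun _ => rfl) (fun _ => rfl) hex

/-- The natural transformation `T_{A,B ∪ i} ⟶ T_{A,B}`. -/
abbrev boxComplexRight (k : Type u) [Field k] (A B : Finset (Fin N)) (i : Fin N) :
    boxComplex k A (insert i B) ⟶ boxComplex k A B :=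
  NatTrans.mapHomologicalComplex (dualHomMap (boxInsertRight k A B i)) _

/-- The natural transformation `T_{A,B} ⟶ T_{A ∪ i,B}`. -/
abbrev boxComplexLeft (k : Type u) [Field k] (A B : Finset (Fin N)) (i : Fin N) :
    boxComplex k A B ⟶ boxComplex k (insert i A) B :=
  NatTrans.mapHomologicalComplex (dualHomMap (boxInsertLeft k A B i)) _

lemma boxComplex_zero (A B : Finset (Fin N)) (i : Fin N) :
    boxComplexRight k A B i ≫ boxComplexLeft k A B i = 0 := by
  rw [boxComplexRight, boxComplexLeft, ← NatTrans.mapHomologicalComplex_comp,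
    dualHomMap_comp_zero _ _ (boxInsert_zero A B i)]
  rfl

lemma boxComplex_shortExact (A B : Finset (Fin N)) (i : Fin N)
    (C : ChainComplex (FreePers k N) ℤ) :
    (ShortComplex.mk ((boxComplexRight k A B i).app C) ((boxComplexLeft k A B i).app C)
      (by rw [← NatTrans.comp_app, boxComplex_zero]; rfl)).ShortExact :=
  HomologicalComplex.shortExact_of_degreewise_shortExact _ fun n =>
    dualHom_shortExact _ _ (boxInsert_zero A B i) (fun v => (boxInsert_exact A B i v).1)
      (fun v => (boxInsert_exact A B i v).2.1) (fun v => (boxInsert_exact A B i v).2.2) (C.X n) _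

lemma exactAt_of_shortExact {S : ShortComplex (ChainComplex (Pers k N) ℤ)} (hS : S.ShortExact)
    (q : ℤ) (h₂ : S.X₂.ExactAt q) (h₁ : S.X₁.ExactAt (q - 1)) : S.X₃.ExactAt q := by
  rw [HomologicalComplex.exactAt_iff_isZero_homology] at *
  exact (hS.homology_exact₃ q (q - 1) (by simp)).isZero_of_both_isZero h₂ h₁

/-- By the long exact sequence, H_q of T_{A∪i,B}C sits between H_q of T_{A,B}C and H_{q-1} of
T_{A,B∪i}C. Both smaller pairs still miss a coordinate, and the shift by one extends the window
downwards. -/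
lemma boxComplex_exactAt (A : Finset (Fin N)) : ∀ (B : Finset (Fin N)), A ∪ B ≠ Finset.univ →
    ∀ (C : ChainComplex (FreePers k N) ℤ) (q : ℤ),
      (∀ i, q - A.card ≤ i → i ≤ q →
        EventuallyVanishes (((forgetFree k N).obj C).homology i)) →
      ((boxComplex k A B).obj C).ExactAt q := by
  induction A using Finset.induction_on with
  | empty =>
    intro B hB C q h
    rw [Finset.empty_union] at hB
    exact boxComplex_exactAt_of_empty hB C q (h q (by simp) le_rfl)
  | insert i A hi ih =>
    intro B hB C q h
    rw [Finset.card_insert_of_notMem hi] at h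
    push_cast at h
    refine exactAt_of_shortExact (boxComplex_shortExact A B i C) q
      (ih B (fun h' => hB ?_) C q fun j h₁ h₂ => h j (by lia) h₂)
      (ih (insert i B) (fun h' => hB ?_) C (q - 1) fun j h₁ h₂ => h j (by lia) (by lia))
    · rw [Finset.insert_union, h', Finset.insert_eq_of_mem (Finset.mem_univ i)]
    · rw [Finset.insert_union, ← Finset.union_insert, h']

/-! ### The morphism `φ` -/

variable [MorphismProperty.HasLocalization.{w} (quasiIsos k N)]

/-- The connecting morphisms are composed while `A` is emptied into `B`. The cardinality is a
separate variable so that the case of all coordinates applies with n = N, and the target keeps a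
shift by 0 so that the base case is an identity. -/
lemma exists_boxComplex_hom (A : Finset (Fin N)) : ∀ (B : Finset (Fin N)), IsCompl A B →
    ∀ n : ℕ, A.card = n →
    ∃ φ : boxComplex k A B ⋙ chainShift (Pers k N) (n : ℤ) ⋙ toDerived k N ⟶
        boxComplex k ∅ Finset.univ ⋙ chainShift (Pers k N) ((0 : ℕ) : ℤ) ⋙ toDerived k N,
      ∀ C : ChainComplex (FreePers k N) ℤ,
        (∀ d : ℤ, (∀ i : ℤ, d ≤ i → i ≤ d + n →
          EventuallyVanishes (((forgetFree k N).obj C).homology i)) →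
          ChainCone.IsIsoOnHomology (φ.app C) d) ∧
        (EventuallyAcyclic ((forgetFree k N).obj C) → IsIso (φ.app C)) := by
  induction A using Finset.induction_on with
  | empty =>
    rintro B hB n hn
    obtain rfl : B = Finset.univ := eq_top_of_bot_isCompl hB
    obtain rfl : n = 0 := hn.symm.trans Finset.card_empty
    refine ⟨𝟙 _, fun C => ⟨fun d _ => ?_, fun _ => ?_⟩⟩
    · exact ChainCone.isIsoOnHomology_of_isIso (𝟙 ((toDerived k N).obj _)) d
    · rw [NatTrans.id_app]
      infer_instance
  | insert i A hi ih =>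
    intro B hB n hn
    obtain rfl : n = A.card + 1 := hn.symm.trans (Finset.card_insert_of_notMem hi)
    have hiB : i ∉ B := fun h =>
      Finset.disjoint_left.1 hB.disjoint (Finset.mem_insert_self i A) h
    -- The coordinate i being moved lies in neither set, which is why the middle complex T_{A,B}C is
    -- exact.
    have hne : A ∪ B ≠ Finset.univ := fun h => by
      have := h ▸ Finset.mem_univ i
      rw [Finset.mem_union] at this
      tauto
    have hcompl : IsCompl A (insert i B) := by
      have h₂ := hB.sup_eq_top
      refine ⟨Finset.disjoint_insert_right.2
        ⟨hi, Finset.disjoint_of_subset_left (Finset.subset_insert i A) hB.disjoint⟩,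
        codisjoint_iff.2 ?_⟩
      rw [← h₂]
      simp
    obtain ⟨φ, hφ⟩ := ih (insert i B) hcompl A.card rfl
    obtain ⟨δ, hδ⟩ := ChainCone.exists_connecting_shift (boxComplexRight k A B i)
      (boxComplexLeft k A B i) (boxComplex_zero A B i) (boxComplex_shortExact A B i)
      (A.card : ℤ) ((A.card + 1 : ℕ) : ℤ) (Nat.cast_succ _)
    refine ⟨δ ≫ φ, fun C => ⟨fun d h => ?_, fun h => ?_⟩⟩
    · push_cast at h
      have h₁ := (hφ C).1 d fun j hj hj' => h j hj (by lia)
      -- Exactness in degrees d + |A| and d + |A| + 1 uses the windows from d to d + |A| and from d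
      -- + 1 to d + |A| + 1, whose union is the hypothesis.
      have h₂ := (hδ C).1 d
        (boxComplex_exactAt A B hne C _ fun j hj hj' => h j (by lia) (by lia))
        (boxComplex_exactAt A B hne C _ fun j hj hj' => by
          push_cast at hj hj'
          exact h j (by lia) (by lia))
      rw [ChainCone.IsIsoOnHomology, NatTrans.comp_app, Functor.map_comp]
      infer_instance
    · have h₁ := (hφ C).2 h
      have h₂ := (hδ C).2 fun d => boxComplex_exactAt A B hne C d fun j _ _ => h j
      rw [NatTrans.comp_app]
      infer_instance

lemma isIso_derivedHomologyMap {K L : ChainComplex (Pers k N) ℤ}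
    (f : (toDerived k N).obj K ⟶ (toDerived k N).obj L) (d : ℤ)
    (hf : ChainCone.IsIsoOnHomology f d) : IsIso (derivedHomologyMap f d) :=
  let e := HomologicalComplexUpToQuasiIso.homologyFunctorFactors (Pers k N) (ComplexShape.down ℤ) d
  IsIso.comp_isIso' (inferInstanceAs (IsIso (e.inv.app K)))
    (IsIso.comp_isIso' hf (inferInstanceAs (IsIso (e.hom.app L))))

/-- The identification of `νC` with the last of the complexes `boxComplex`. -/
def nakayamaComplexIso (k : Type u) [Field k] (N : ℕ) :
    nakayamaComplex k N ≅ boxComplex k (Finset.univ : Finset (Fin N)) ∅ :=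
  NatIso.mapHomologicalComplex (nakayamaIso k N ≪≫ dualHomIso (boxUnivIso k N)) _

/-- The identification of `C` with the first of the complexes `boxComplex`. -/
def forgetFreeIso (k : Type u) [Field k] (N : ℕ) :
    forgetFree k N ≅ boxComplex k (∅ : Finset (Fin N)) Finset.univ :=
  NatIso.mapHomologicalComplex (boxDualUnivIso k N) _

end MultiPers

end

/-! ### The main theorem -/

open MultiPers
theorem mainTheorem2 (k : Type u) [Field k] (N : ℕ)
    [MorphismProperty.HasLocalization.{w} (quasiIsos k N)] :
    ∃ φ : nakayamaComplex k N ⋙ chainShift (Pers k N) (N : ℤ) ⋙ toDerived k N ⟶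
        forgetFree k N ⋙ toDerived k N,
      ∀ C : ChainComplex (FreePers k N) ℤ,
        (∀ d : ℤ,
          (∀ i : ℤ, d ≤ i → i ≤ d + N → EventuallyVanishes (((forgetFree k N).obj C).homology i)) →
          IsIso (X := ((nakayamaComplex k N).obj C).homology (d + N))
            (Y := ((forgetFree k N).obj C).homology d)
            ((chainShiftHomologyIso (N : ℤ) ((nakayamaComplex k N).obj C) d).inv ≫
              derivedHomologyMap (φ.app C) d)) ∧
        (EventuallyAcyclic ((forgetFree k N).obj C) → IsIso (φ.app C)) := by
  obtain ⟨φ, hφ⟩ := exists_boxComplex_hom (k := k) (Finset.univ : Finset (Fin N)) ∅ isCompl_top_bot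
    N (Finset.card_fin N)
  let e := Functor.isoWhiskerRight (nakayamaComplexIso k N)
    (chainShift (Pers k N) (N : ℤ) ⋙ toDerived k N)
  -- Removes the shift by 0 left over from the induction and then identifies T_{∅,univ}C with C.
  let e' := Functor.isoWhiskerLeft (boxComplex k (∅ : Finset (Fin N)) Finset.univ)
      (Functor.isoWhiskerRight (ChainCone.chainShiftZeroIso (Pers k N) ((0 : ℕ) : ℤ) Nat.cast_zero) (toDerived k N)) ≪≫
    Functor.isoWhiskerRight (forgetFreeIso k N).symm (toDerived k N)
  refine ⟨e.hom ≫ φ ≫ e'.hom, fun C => ⟨fun d h => ?_, fun h => ?_⟩⟩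
  · have := (hφ C).1 d h
    have : ChainCone.IsIsoOnHomology ((e.hom ≫ φ ≫ e'.hom).app C) d := by
      rw [ChainCone.IsIsoOnHomology, NatTrans.comp_app, NatTrans.comp_app, Functor.map_comp,
        Functor.map_comp]
      infer_instance
    have := isIso_derivedHomologyMap ((e.hom ≫ φ ≫ e'.hom).app C) d this
    infer_instance
  · have := (hφ C).2 h
    rw [NatTrans.comp_app, NatTrans.comp_app]
    infer_instance
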